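/- **Setting.** Let $d\in\mathbb N$, $T>0$, $T\mathbb R^d=\mathbb R^d\times\mathbb R^d$ (points $(x,v)$: position, velocity), let $\mathcal P(X)$ be the Borel probability measures on $X$ and $\mathcal P_c(\mathbb R^d)$ those with compact support. Let $W$ be the 1-Wasserstein distance on $\mathbb R^d$ (infimum of $\int|x-y|\,d\gamma$ over transference plans $\gamma$; Euclidean norm). For $V_1,V_2\in\mathcal P(T\mathbb R^d)$ with first marginals $\mu_1,\mu_2$ let $$\mathcal W(V_1,V_2)=\inf\int|v-w|\,d\theta(x,v,y,w),$$ the infimum being over the transference plans $\theta$ from $V_1$ to $V_2$ whose image under $(x,v,y,w)\mapsto(x,y)$ is an optimal transference plan from $\mu_1$ to $\mu_2$ (for the cost $|x-y|$). A *probability vector field* (PVF) is a map $V:\mathcal P(\mathbb R^d)\to\mathcal P(T\mathbb R^d)$ such that the first marginal of $V[\mu]$ is $\mu$ for every $\mu$. Consider the conditions * (H1) there is $C>0$ such that $|v|\le C\,(1+\sup_{y\in\operatorname{supp}\mu}|y|)$ for all $\mu\in\mathcal P_c(\mathbb R^d)$ and all $(x,v)\in\operatorname{supp}V[\mu]$;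 * (H3) for every $R>0$ there is $L>0$ such that $\mathcal W(V[\mu],V[\nu])\le L\,W(\mu,\nu)$ for all $\mu,\nu\in\mathcal P_c(\mathbb R^d)$ with supports in the open ball $B(0,R)$. A *solution* of the measure differential equation $\dot\mu_t=V[\mu_t]$ with initial datum $\mu_0$ is a map $t\mapsto\mu_t\in\mathcal P(\mathbb R^d)$ on $[0,T]$ with value $\mu_0$ at $t=0$ such that: for every $f\in C_c^\infty(\mathbb R^d)$ the map $t\mapsto\int\nabla f(x)\cdot v\,dV[\mu_t](x,v)$ belongs to $L^1([0,T])$ and $t\mapsto\int f\,d\mu_t$ is absolutely continuous on $[0,T]$; and for a.e. $t\in[0,T]$, for all $f\in C^\infty_c(\mathbb R^d)$, the function $(x,v)\mapsto\nabla f(x)\cdot v$ is $V[\mu_t]$-integrable and $\frac{d}{dt}\int f\,d\mu_t=\int\nabla f(x)\cdot v\,dV[\mu_t](x,v)$. *Semi-discrete Lagrangian scheme.* For $N\ge1$ put $\Delta t=T/N$, $t_k=k\Delta t$, and $$\bar\mu^N_0=\mu_0,\qquad \bar\mu^N_t=\int_{T\mathbb R^d}\delta_{x+(t-t_k)v}\,dV[\bar\mu^N_{t_k}](x,v)\quad\text{for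 }t\in(t_k,t_{k+1}],\ 0\le k<N.$$ *Lattice Approximate Solutions (LAS).* For $N\ge1$ let $x_i$ be the points of $\frac{T}{N^2}\mathbb Z^d\cap[-TN,TN]^d$ and $v_j$ those of $\frac1N\mathbb Z^d\cap[-N,N]^d$, and put $$\mu^N_0=\sum_i\mu_0\big(x_i+[0,\tfrac T{N^2})^d\big)\,\delta_{x_i},\qquad \mu^N_t=\sum_{i,j}V[\mu^N_{t_k}]\big(\{x_i\}\times(v_j+[0,\tfrac1N)^d)\big)\,\delta_{x_i+(t-t_k)v_j}\quad\text{for }t\in(t_k,t_{k+1}].$$ (If $\mu^N_{t_k}$ is not a probability measure because mass has left the bounded grid, $\mu^N_t$ is set to $0$ for $t\in(t_k,t_{k+1}]$; convergence as $N\to\infty$ only concerns large $N$.) **Theorem.** Let $V$ be a PVF satisfying (H1) and (H3), and let $\mu_0\in\mathcal P_c(\mathbb R^d)$. 1. There are a strictly increasing sequence $(N_n)$ and a solution $t\mapsto\mu_t$ of $\dot\mu_t=V[\mu_t]$ with initial datum $\mu_0$, with $\mu_t\in\mathcal P_c(\mathbb R^d)$ for all $t\in[0,T]$, such that $\sup_{t\in[0,T]}W(\bar\mu^{N_n}_t,\mu_t)\to0$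 as $n\to\infty$. 2. Let $(N_n)$ be a strictly increasing sequence and let $\mu,\nu:[0,T]\to\mathcal P(\mathbb R^d)$ be such that $W(\bar\mu^{N_n}_t,\mu_t)\to0$ and $W(\mu^{N_n}_t,\nu_t)\to0$ for every $t\in[0,T]$. Then $\mu_t=\nu_t\in\mathcal P_c(\mathbb R^d)$ for every $t\in[0,T]$, and $t\mapsto\mu_t$ is a solution of $\dot\mu_t=V[\mu_t]$ with initial datum $\mu_0$. -/

import Mathlib

open MeasureTheory Filter Topology Set
open scoped ENNReal NNReal ContDiff

noncomputable section

namespace MDE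

/-- The space of positions (and of velocities), with the Euclidean norm. -/
abbrev Pos (d : ℕ) := EuclideanSpace ℝ (Fin d)

/-- The tangent bundle: pairs `(x, v)` of a position and a velocity. -/
abbrev TPos (d : ℕ) := Pos d × Pos d

/-- The set of Borel probability measures. -/
abbrev Prob (X : Type*) [MeasurableSpace X] := ProbabilityMeasure X

/-- Transference plans between two measures. -/
def Plans {X Y : Type*} [MeasurableSpace X] [MeasurableSpace Y]
    (μ : Measure X) (ν : Measure Y) : Set (Measure (X × Y)) :=
  {γ | γ.map Prod.fst = μ ∧ γ.map Prod.snd = ν}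

/-- The 1-Wasserstein distance, with values in `[0, ∞]`. -/
def W1 {d : ℕ} (μ ν : Measure (Pos d)) : ℝ≥0∞ :=
  ⨅ γ ∈ Plans μ ν, ∫⁻ p, edist p.1 p.2 ∂γ

/-- Optimal transference plans for the cost `|x - y|`. -/
def OptPlans {d : ℕ} (μ ν : Measure (Pos d)) : Set (Measure (Pos d × Pos d)) :=
  {γ | γ ∈ Plans μ ν ∧ ∫⁻ p, edist p.1 p.2 ∂γ = W1 μ ν}

/-- The quantity `𝒲(V₁, V₂)`: the least cost `∫ |v - w|` over the transference plans
`θ` on points `((x, v), (y, w))` between `V₁` and `V₂` that transport the base marginals optimally. -/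
def fiberW {d : ℕ} (V₁ V₂ : Measure (TPos d)) : ℝ≥0∞ :=
  ⨅ θ ∈ {θ | θ ∈ Plans V₁ V₂ ∧
      θ.map (fun q : TPos d × TPos d => (q.1.1, q.2.1)) ∈
        OptPlans (V₁.map Prod.fst) (V₂.map Prod.fst)},
    ∫⁻ q, edist q.1.2 q.2.2 ∂θ

/-- Compactly supported probability measures. -/
def CompSupp {d : ℕ} (μ : Prob (Pos d)) : Prop :=
  IsCompact (μ : Measure (Pos d)).support

/-- Probability vector fields: the first marginal of `V[μ]` is `μ`. -/
def IsPVF {d : ℕ} (V : Prob (Pos d) → Prob (TPos d)) : Prop :=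
  ∀ μ : Prob (Pos d), (V μ : Measure (TPos d)).map Prod.fst = (μ : Measure (Pos d))

/-- Sublinearity of a probability vector field. -/
def Sublinear {d : ℕ} (V : Prob (Pos d) → Prob (TPos d)) : Prop :=
  ∃ C : ℝ, 0 < C ∧ ∀ μ : Prob (Pos d), CompSupp μ →
    ∀ p ∈ (V μ : Measure (TPos d)).support,
      ‖p.2‖ ≤ C * (1 + sSup ((fun x => ‖x‖) '' (μ : Measure (Pos d)).support))

/-- Local Lipschitz condition on a probability vector field. -/
def LocLip {d : ℕ} (V : Prob (Pos d) → Prob (TPos d)) : Prop :=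
  ∀ R : ℝ, 0 < R → ∃ L : ℝ≥0, 0 < L ∧ ∀ μ ν : Prob (Pos d), CompSupp μ → CompSupp ν →
    (μ : Measure (Pos d)).support ⊆ Metric.ball 0 R →
    (ν : Measure (Pos d)).support ⊆ Metric.ball 0 R →
    fiberW (V μ : Measure (TPos d)) (V ν : Measure (TPos d)) ≤ L * W1 (μ : Measure (Pos d)) ν

/-- Solutions on `[0, T]` of the measure differential equation `μ' = V[μ]` with initial datum `μ₀`.
Only the values `μ t` with `t ∈ [0, T]` matter; `fderiv ℝ f x v` is `∇f(x) · v`. -/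
structure IsSolution {d : ℕ} (V : Prob (Pos d) → Prob (TPos d)) (T : ℝ) (μ₀ : Prob (Pos d))
    (μ : ℝ → Prob (Pos d)) : Prop where
  init : μ 0 = μ₀
  defined : ∀ᵐ t ∂(volume.restrict (Icc 0 T)), ∀ f : Pos d → ℝ, ContDiff ℝ ∞ f →
    HasCompactSupport f →
    Integrable (fun p : TPos d => fderiv ℝ f p.1 p.2) (V (μ t) : Measure (TPos d))
  integrable : ∀ f : Pos d → ℝ, ContDiff ℝ ∞ f → HasCompactSupport f →
    IntegrableOn (fun t => ∫ p : TPos d, fderiv ℝ f p.1 p.2 ∂(V (μ t) : Measure (TPos d)))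
      (Icc 0 T)
  absCont : ∀ f : Pos d → ℝ, ContDiff ℝ ∞ f → HasCompactSupport f →
    AbsolutelyContinuousOnInterval (fun t => ∫ x, f x ∂(μ t : Measure (Pos d))) 0 T
  deriv_eq : ∀ᵐ t ∂(volume.restrict (Icc 0 T)), ∀ f : Pos d → ℝ, ContDiff ℝ ∞ f →
    HasCompactSupport f →
    HasDerivAt (fun s => ∫ x, f x ∂(μ s : Measure (Pos d)))
      (∫ p : TPos d, fderiv ℝ f p.1 p.2 ∂(V (μ t) : Measure (TPos d))) t

/-- For `t > 0` and a step `τ > 0`, the index `k` with `t ∈ (k τ, (k + 1) τ]`. -/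
def stepIndex (τ t : ℝ) : ℕ := ⌈t / τ⌉₊ - 1

/-- The measure `∫ δ_{x + s v} dV[μ](x, v)`, i.e. the image of `V[μ]` under `(x, v) ↦ x + s v`. -/
def lagStep {d : ℕ} (V : Prob (Pos d) → Prob (TPos d)) (s : ℝ) (μ : Prob (Pos d)) :
    Prob (Pos d) :=
  (V μ).map (f := fun p : TPos d => p.1 + s • p.2) (by fun_prop)

/-- The semi-discrete Lagrangian scheme at the nodes `k τ`. -/
def lagNode {d : ℕ} (V : Prob (Pos d) → Prob (TPos d)) (τ : ℝ) (μ₀ : Prob (Pos d)) :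
    ℕ → Prob (Pos d)
  | 0 => μ₀
  | k + 1 => lagStep V τ (lagNode V τ μ₀ k)

/-- The semi-discrete Lagrangian scheme with `N` steps on `[0, T]`, at all times `t ∈ [0, T]`. -/
def lagScheme {d : ℕ} (V : Prob (Pos d) → Prob (TPos d)) (T : ℝ) (μ₀ : Prob (Pos d)) (N : ℕ)
    (t : ℝ) : Prob (Pos d) :=
  if t ≤ 0 then μ₀
  else lagStep V (t - stepIndex (T / N) t * (T / N))
    (lagNode V (T / N) μ₀ (stepIndex (T / N) t))

/-- The integer vectors with all entries in `[-M, M]`. -/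
def box (d M : ℕ) : Finset (Fin d → ℤ) :=
  Fintype.piFinset fun _ => Finset.Icc (-(M : ℤ)) (M : ℤ)

/-- The lattice point `h i`. -/
def latticePt {d : ℕ} (h : ℝ) (i : Fin d → ℤ) : Pos d :=
  WithLp.toLp 2 fun l => h * (i l : ℝ)

/-- The half-open cube `x + [0, h)^d`. -/
def cube {d : ℕ} (h : ℝ) (x : Pos d) : Set (Pos d) :=
  {y | ∀ l, x l ≤ y l ∧ y l < x l + h}

/-- The space discretization `𝒜ˣ_N(μ) = ∑ᵢ μ(xᵢ + [0, T/N²)^d) δ_{xᵢ}`, the `xᵢ` being the points of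
`(T/N²) ℤ^d ∩ [-TN, TN]^d`. -/
def spaceDisc {d : ℕ} (T : ℝ) (N : ℕ) (μ : Measure (Pos d)) : Measure (Pos d) :=
  ∑ i ∈ box d (N ^ 3),
    μ (cube (T / N ^ 2) (latticePt (T / N ^ 2) i)) • Measure.dirac (latticePt (T / N ^ 2) i)

/-- The measure `∑ᵢⱼ V[m]({xᵢ} × (vⱼ + [0, 1/N)^d)) δ_{xᵢ + s vⱼ}`, with `xᵢ` as in `spaceDisc` and
`vⱼ` the points of `(1/N) ℤ^d ∩ [-N, N]^d`. As the grid is bounded, mass may be lost outside of it when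
`N` is small; `V[m]` then makes no sense and the value is set to `0`. -/
def latStep {d : ℕ} (V : Prob (Pos d) → Prob (TPos d)) (T : ℝ) (N : ℕ) (s : ℝ)
    (m : Measure (Pos d)) : Measure (Pos d) :=
  open Classical in
  if h : IsProbabilityMeasure m then
    ∑ i ∈ box d (N ^ 3), ∑ j ∈ box d (N ^ 2),
      (V ⟨m, h⟩ : Measure (TPos d))
          ({latticePt (T / N ^ 2) i} ×ˢ cube (1 / N) (latticePt (1 / N) j)) •
        Measure.dirac (latticePt (T / N ^ 2) i + s • latticePt (1 / N) j)
  else 0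

/-- The Lattice Approximate Solution at the nodes `k T / N`. -/
def latNode {d : ℕ} (V : Prob (Pos d) → Prob (TPos d)) (T : ℝ) (μ₀ : Prob (Pos d)) (N : ℕ) :
    ℕ → Measure (Pos d)
  | 0 => spaceDisc T N (μ₀ : Measure (Pos d))
  | k + 1 => latStep V T N (T / N) (latNode V T μ₀ N k)

/-- The Lattice Approximate Solution at all times `t ∈ [0, T]`. -/
def latSol {d : ℕ} (V : Prob (Pos d) → Prob (TPos d)) (T : ℝ) (μ₀ : Prob (Pos d)) (N : ℕ)
    (t : ℝ) : Measure (Pos d) :=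
  if t ≤ 0 then spaceDisc T N (μ₀ : Measure (Pos d))
  else latStep V T N (t - stepIndex (T / N) t * (T / N))
    (latNode V T μ₀ N (stepIndex (T / N) t))

end MDE

end

/-! Linear growth of the velocities and a discrete Gronwall argument keep both schemes in one ball,
on which `V` has speed at most `M` and a Lipschitz constant `L` (`ControlledOn`).

The key fact is that, for a test function `f`, the drift `∫ ∇f(x) · v dV[μ]` is Lipschitz in `μ` for
`W1` on that ball. Couple `V[μ]` and `V[ν]` by a plan admissible for `fiberW`: its base is optimal,
so the change of `∇f` is paid by `W1` and the change of `v` by `fiberW` (`enorm_drift_sub_le`).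
Along an Euler curve of step `τ`, the increment of `∫ f` over `[s, t]` is then `t - s` times the
drift at `s`, up to `O((t - s)² + τ (t - s))` (`IsEulerCurve.abs_integral_sub_sub_drift_le`). Every
term passes to pointwise `W1` limits, and `τ → 0` leaves a quadratic remainder, which gives the
equation at every interior time (`isSolution_of_tendsto_W1`).

Convergent subsequences come from Arzelà–Ascoli (`exists_subseq_tendsto_iSup_W1`): the curves are
equi-Lipschitz when tested against Lipschitz functions, and finitely many such tests control `W1` in
a ball up to `ε` (`exists_testFunctions`).

For the lattice scheme, an admissible plan pushed through one step shows that its distance to the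
Lagrangian scheme grows by a factor `1 + L T / N`, up to rounding errors (`W1_step_le`). The schemes
with the same `N` are thus `O(1/N)` apart (`exists_latSol_eq`) and share their limits; uniqueness of
solutions plays no role. Nor does the triangle inequality for `W1`: distances are compared through
plans or through integrals. -/

namespace MDE

/-! ### Transport plans and the bounds they give -/

section Couplings

lemma W1_le_of_mem_plans {d : ℕ} {μ ν : Measure (Pos d)} {γ : Measure (Pos d × Pos d)}
    (h : γ ∈ Plans μ ν) : W1 μ ν ≤ ∫⁻ p, edist p.1 p.2 ∂γ :=
  iInf₂_le γ h

lemma W1_map_le {d : ℕ} {Ω : Type*} [MeasurableSpace Ω] (P : Measure Ω) {a b : Ω → Pos d}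
    (ha : Measurable a) (hb : Measurable b) :
    W1 (P.map a) (P.map b) ≤ ∫⁻ p, edist (a p) (b p) ∂P := by
  have hab : Measurable fun p => (a p, b p) := ha.prodMk hb
  refine (W1_le_of_mem_plans (γ := P.map fun p => (a p, b p)) ⟨?_, ?_⟩).trans ?_
  · rw [Measure.map_map measurable_fst hab]; rfl
  · rw [Measure.map_map measurable_snd hab]; rfl
  · rw [lintegral_map (by fun_prop) hab]

lemma enorm_integral_sub_le_of_plan {X Y : Type*} [MeasurableSpace X] [MeasurableSpace Y]
    {μ : Measure X} {ν : Measure Y} {γ : Measure (X × Y)} (hγ : γ ∈ Plans μ ν)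
    {f : X → ℝ} {g : Y → ℝ} (hf : Integrable f μ) (hg : Integrable g ν) :
    ‖∫ x, f x ∂μ - ∫ y, g y ∂ν‖ₑ ≤ ∫⁻ p, ‖f p.1 - g p.2‖ₑ ∂γ := by
  obtain ⟨rfl, rfl⟩ := hγ
  have h1 : Integrable (fun p : X × Y => f p.1) γ := hf.comp_measurable measurable_fst
  have h2 : Integrable (fun p : X × Y => g p.2) γ := hg.comp_measurable measurable_snd
  rw [integral_map measurable_fst.aemeasurable hf.aestronglyMeasurable,
    integral_map measurable_snd.aemeasurable hg.aestronglyMeasurable, ← integral_sub h1 h2]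
  exact enorm_integral_le_lintegral_enorm _

/-- The easy half of Kantorovich duality. The condition `K ≠ 0` matters because `0 * ∞ = 0`: between
measures of different mass there is no plan and `W1` is infinite. -/
lemma enorm_integral_sub_le_W1 {d : ℕ} {f : Pos d → ℝ} {K : ℝ≥0} (hK : K ≠ 0)
    (hf : LipschitzWith K f) {μ ν : Measure (Pos d)} (hμ : Integrable f μ)
    (hν : Integrable f ν) :
    ‖∫ x, f x ∂μ - ∫ x, f x ∂ν‖ₑ ≤ K * W1 μ ν := by
  unfold W1
  rw [ENNReal.mul_iInf_of_ne (by simpa using hK) ENNReal.coe_ne_top]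
  refine le_iInf fun γ => ?_
  rw [ENNReal.mul_iInf_of_ne (by simpa using hK) ENNReal.coe_ne_top]
  refine le_iInf fun h => (enorm_integral_sub_le_of_plan h hμ hν).trans ?_
  rw [← lintegral_const_mul _ (by fun_prop)]
  refine lintegral_mono fun p => ?_
  simpa [edist_eq_enorm_sub] using hf p.1 p.2

/-- A bound valid for every admissible plan in the definition of `fiberW` holds for `fiberW`. -/
lemma le_add_mul_fiberW {d : ℕ} {P Q : Measure (TPos d)} {X Y : ℝ≥0∞} {B : ℝ≥0} (hB : B ≠ 0)
    (h : ∀ θ ∈ Plans P Q, ∫⁻ q, edist q.1.1 q.2.1 ∂θ = W1 (P.map Prod.fst) (Q.map Prod.fst) →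
      X ≤ Y + B * ∫⁻ q, edist q.1.2 q.2.2 ∂θ) :
    X ≤ Y + B * fiberW P Q := by
  unfold fiberW
  rw [ENNReal.mul_iInf_of_ne (by simpa using hB) ENNReal.coe_ne_top, ENNReal.add_iInf]
  refine le_iInf fun θ => ?_
  rw [ENNReal.mul_iInf_of_ne (by simpa using hB) ENNReal.coe_ne_top, ENNReal.add_iInf]
  refine le_iInf fun hθ => h θ hθ.1 ?_
  rw [← hθ.2.2, lintegral_map (by fun_prop) (by fun_prop)]

/-- The total transport rate `∫ ∇f(x) · v dP(x, v)` of a test function. -/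
noncomputable def drift {d : ℕ} (f : Pos d → ℝ) (P : Measure (TPos d)) : ℝ :=
  ∫ p, fderiv ℝ f p.1 p.2 ∂P

lemma integrable_fderiv_apply {d : ℕ} {f : Pos d → ℝ} {B : ℝ} {M : ℝ}
    (hf : Continuous (fderiv ℝ f)) (hB : ∀ x, ‖fderiv ℝ f x‖ ≤ B)
    {P : Measure (TPos d)} [IsFiniteMeasure P] (hP : ∀ᵐ p ∂P, ‖p.2‖ ≤ M) :
    Integrable (fun p : TPos d => fderiv ℝ f p.1 p.2) P := by
  have hc : Continuous fun p : TPos d => fderiv ℝ f p.1 p.2 := by fun_prop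
  refine Integrable.of_bound hc.aestronglyMeasurable (B * M) ?_
  filter_upwards [hP] with p hp
  have hB0 : 0 ≤ B := (norm_nonneg _).trans (hB 0)
  exact (ContinuousLinearMap.le_opNorm _ _).trans (mul_le_mul (hB _) hp (norm_nonneg _) hB0)

/-- Split `∇f(x) · v - ∇f(y) · w` into `(∇f(x) - ∇f(y)) · v` and `∇f(y) · (v - w)`. Since the base
of an admissible plan is optimal, the first term integrates to at most `A M` times `W1` itself. -/
lemma enorm_drift_sub_le {d : ℕ} {f : Pos d → ℝ} {A B M : ℝ≥0} (hB0 : B ≠ 0)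
    (hA : LipschitzWith A (fderiv ℝ f)) (hB : ∀ x, ‖fderiv ℝ f x‖ ≤ B)
    {P Q : Measure (TPos d)} [IsFiniteMeasure P] [IsFiniteMeasure Q]
    (hP : ∀ᵐ p ∂P, ‖p.2‖ ≤ M) (hQ : ∀ᵐ p ∂Q, ‖p.2‖ ≤ M) :
    ‖drift f P - drift f Q‖ₑ ≤
      (A * M) * W1 (P.map Prod.fst) (Q.map Prod.fst) + B * fiberW P Q := by
  refine le_add_mul_fiberW hB0 fun θ hθ hθW => ?_
  refine (enorm_integral_sub_le_of_plan hθ (integrable_fderiv_apply hA.continuous hB hP)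
    (integrable_fderiv_apply hA.continuous hB hQ)).trans ?_
  rw [← hθW, ← lintegral_const_mul _ (by fun_prop), ← lintegral_const_mul _ (by fun_prop),
    ← lintegral_add_left (by fun_prop)]
  have hPθ : ∀ᵐ q ∂θ, ‖q.1.2‖ ≤ M := by
    rw [← hθ.1] at hP
    exact ae_of_ae_map measurable_fst.aemeasurable hP
  refine lintegral_mono_ae ?_
  filter_upwards [hPθ] with q hq
  have h1 : fderiv ℝ f q.1.1 q.1.2 - fderiv ℝ f q.2.1 q.2.2 =
      (fderiv ℝ f q.1.1 - fderiv ℝ f q.2.1) q.1.2 + fderiv ℝ f q.2.1 (q.1.2 - q.2.2) := by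
    simp
  rw [h1, edist_eq_enorm_sub q.1.2]
  refine (enorm_add_le _ _).trans (add_le_add ?_ ?_)
  · refine (ContinuousLinearMap.le_opENorm _ _).trans ?_
    rw [mul_right_comm]
    refine mul_le_mul' ?_ ?_
    · simpa [edist_eq_enorm_sub] using hA q.1.1 q.2.1
    · exact_mod_cast hq
  · refine (ContinuousLinearMap.le_opENorm _ _).trans ?_
    gcongr
    exact_mod_cast hB q.2.1

/-- A transport bound from decompositions of two probability measures into matching pieces:
corresponding pieces are at distance at most `ε`, everything is at distance at most `D`. -/
lemma W1_le_of_sum {d : ℕ} {ι : Type*} [Fintype ι] {μ ν : Measure (Pos d)}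
    [IsProbabilityMeasure μ] [IsProbabilityMeasure ν] {m n : ι → Measure (Pos d)}
    (hm : ∑ i, m i = μ) (hn : ∑ i, n i = ν) {ε D : ℝ≥0∞}
    (hε : ∀ i, ∀ᵐ p ∂((m i).prod (n i)), edist p.1 p.2 ≤ ε)
    (hD : ∀ᵐ p ∂(μ.prod ν), edist p.1 p.2 ≤ D) :
    W1 μ ν ≤ ε + D * ∑ i, (m i univ - n i univ) := by
  have hmμ : ∀ i, m i ≤ μ := fun i => hm ▸
    Finset.single_le_sum (f := m) (fun _ _ => Measure.zero_le _) (Finset.mem_univ i)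
  have hnν : ∀ i, n i ≤ ν := fun i => hn ▸
    Finset.single_le_sum (f := n) (fun _ _ => Measure.zero_le _) (Finset.mem_univ i)
  have hmfin : ∀ i, IsFiniteMeasure (m i) := fun i =>
    ⟨((hmμ i univ).trans_eq measure_univ).trans_lt ENNReal.one_lt_top⟩
  have hnfin : ∀ i, IsFiniteMeasure (n i) := fun i =>
    ⟨((hnν i univ).trans_eq measure_univ).trans_lt ENNReal.one_lt_top⟩
  set a : ι → ℝ≥0∞ := fun i => m i univ with ha
  set b : ι → ℝ≥0∞ := fun i => n i univ with hb
  have hat : ∀ i, a i ≠ ⊤ := fun i => measure_ne_top _ _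
  have hbt : ∀ i, b i ≠ ⊤ := fun i => measure_ne_top _ _
  have hsa : ∑ i, a i = 1 := by
    rw [← measure_univ (μ := μ), ← hm]; simp [ha]
  have hsb : ∑ i, b i = 1 := by
    rw [← measure_univ (μ := ν), ← hn]; simp [hb]
  -- `k i` is the mass that can be matched inside piece `i`. The measure `c i • (m i).prod (n i)`
  -- has that mass, and its marginals are the fractions `c i * b i` of `m i` and `c i * a i` of `n
  -- i`; an empty piece is harmless since `0 / 0 = 0`.
  set k : ι → ℝ≥0∞ := fun i => min (a i) (b i) with hk
  set c : ι → ℝ≥0∞ := fun i => k i / (a i * b i) with hc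
  have hk0 : ∀ i, a i = 0 ∨ b i = 0 → k i = 0 := by
    rintro i (h | h) <;> simp [hk, h]
  have hcab : ∀ i, c i * (a i * b i) = k i := by
    intro i
    by_cases h : a i * b i = 0
    · rw [h, mul_zero, hk0 i (by simpa using h)]
    · exact ENNReal.div_mul_cancel h (ENNReal.mul_ne_top (hat i) (hbt i))
  have hca : ∀ i, c i * a i ≤ 1 := by
    intro i
    by_cases h : b i = 0
    · simp [hc, hk0 i (Or.inr h)]
    · rw [← ENNReal.mul_le_mul_iff_left h (hbt i), mul_assoc, hcab, one_mul]
      exact min_le_right _ _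
  have hcb : ∀ i, c i * b i ≤ 1 := by
    intro i
    by_cases h : a i = 0
    · simp [hc, hk0 i (Or.inl h)]
    · rw [← ENNReal.mul_le_mul_iff_left h (hat i), mul_assoc, mul_comm (b i), hcab, one_mul]
      exact min_le_left _ _
  set μ' : Measure (Pos d) := ∑ i, (1 - c i * b i) • m i with hμ'
  set ν' : Measure (Pos d) := ∑ i, (1 - c i * a i) • n i with hν'
  have hsμ : ∑ i, (c i * b i) • m i + μ' = μ := by
    rw [← hm, hμ', ← Finset.sum_add_distrib]
    refine Finset.sum_congr rfl fun i _ => ?_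
    rw [← add_smul, add_tsub_cancel_of_le (hcb i), one_smul]
  have hsν : ∑ i, (c i * a i) • n i + ν' = ν := by
    rw [← hn, hν', ← Finset.sum_add_distrib]
    refine Finset.sum_congr rfl fun i _ => ?_
    rw [← add_smul, add_tsub_cancel_of_le (hca i), one_smul]
  have hμle : μ' ≤ μ := hsμ ▸ Measure.le_add_left le_rfl
  have hνle : ν' ≤ ν := hsν ▸ Measure.le_add_left le_rfl
  set r := ∑ i, (a i - b i) with hr
  have hμr : μ' univ = r := by
    simp only [hμ', hr, Measure.coe_finsetSum, Finset.sum_apply, Measure.smul_apply, smul_eq_mul]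
    refine Finset.sum_congr rfl fun i _ => ?_
    rw [ENNReal.sub_mul fun _ _ => hat i, one_mul, mul_assoc, mul_comm (b i), hcab, hk, tsub_min]
  have hkt : ∑ i, k i ≠ ⊤ := ENNReal.sum_ne_top.2 fun i _ => ne_top_of_le_ne_top (hat i)
    (min_le_left _ _)
  have hνr : ν' univ = r := by
    have h1 : μ' univ + ∑ i, k i = 1 := by
      have := congrArg (fun κ : Measure (Pos d) => κ univ) hsμ
      simp only [Measure.coe_add, Pi.add_apply, Measure.coe_finsetSum, Finset.sum_apply,
        Measure.smul_apply, smul_eq_mul, measure_univ] at this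
      rw [← this, add_comm]
      congr 1
      exact Finset.sum_congr rfl fun i _ => by rw [mul_assoc, mul_comm (b i), ← hcab]
    have h2 : ν' univ + ∑ i, k i = 1 := by
      have := congrArg (fun κ : Measure (Pos d) => κ univ) hsν
      simp only [Measure.coe_add, Pi.add_apply, Measure.coe_finsetSum, Finset.sum_apply,
        Measure.smul_apply, smul_eq_mul, measure_univ] at this
      rw [← this, add_comm]
      congr 1
      exact Finset.sum_congr rfl fun i _ => by rw [mul_assoc, ← hcab]
    rw [← hμr]
    exact (ENNReal.add_left_inj hkt).1 (h2.trans h1.symm)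
  have : IsFiniteMeasure μ' := isFiniteMeasure_of_le μ hμle
  have : IsFiniteMeasure ν' := isFiniteMeasure_of_le ν hνle
  have hrt : r ≠ ⊤ := hμr ▸ measure_ne_top _ _
  have hrμ : (r⁻¹ * r) • μ' = μ' := by
    by_cases h : r = 0
    · rw [h, Measure.measure_univ_eq_zero] at hμr
      simp [hμr]
    · rw [ENNReal.inv_mul_cancel h hrt, one_smul]
  have hrν : (r⁻¹ * r) • ν' = ν' := by
    by_cases h : r = 0
    · rw [h, Measure.measure_univ_eq_zero] at hνr
      simp [hνr]
    · rw [ENNReal.inv_mul_cancel h hrt, one_smul]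
  -- Matched mass stays within its piece; the leftovers, of common mass `r`, are coupled by their
  -- normalised product. For `r = 0` that product vanishes, and so does its multiple by `r⁻¹ = ∞`.
  set γ : Measure (Pos d × Pos d) :=
    ∑ i, c i • (m i).prod (n i) + r⁻¹ • μ'.prod ν' with hγ
  have hγP : γ ∈ Plans μ ν := by
    constructor
    · rw [hγ, Measure.map_add _ _ measurable_fst, Measure.map_finset_sum measurable_fst.aemeasurable]
      simp only [Measure.map_smul, Measure.map_fst_prod, smul_smul, hνr, hrμ]
      exact hsμ
    · rw [hγ, Measure.map_add _ _ measurable_snd, Measure.map_finset_sum measurable_snd.aemeasurable]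
      simp only [Measure.map_smul, Measure.map_snd_prod, smul_smul, hμr, hrν]
      exact hsν
  refine (W1_le_of_mem_plans hγP).trans ?_
  rw [hγ, lintegral_add_measure, lintegral_finsetSum_measure]
  refine add_le_add ?_ ?_
  · calc ∑ i, ∫⁻ p, edist p.1 p.2 ∂(c i • (m i).prod (n i)) ≤ ∑ i, ε * a i := by
          refine Finset.sum_le_sum fun i _ => ?_
          rw [lintegral_smul_measure, smul_eq_mul]
          calc c i * ∫⁻ p, edist p.1 p.2 ∂(m i).prod (n i)
              ≤ c i * ∫⁻ _, ε ∂(m i).prod (n i) := by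
                gcongr 1
                exact lintegral_mono_ae (hε i)
            _ = ε * k i := by
                rw [lintegral_const, ← univ_prod_univ, Measure.prod_prod, mul_left_comm, hcab]
            _ ≤ ε * a i := by gcongr; exact min_le_left _ _
      _ = ε := by rw [← Finset.mul_sum, hsa, mul_one]
  · rw [lintegral_smul_measure, smul_eq_mul]
    calc r⁻¹ * ∫⁻ p, edist p.1 p.2 ∂μ'.prod ν' ≤ r⁻¹ * ∫⁻ _, D ∂μ'.prod ν' := by
          gcongr 1
          exact lintegral_mono_ae (ae_mono (Measure.prod_mono hμle hνle) hD)
      _ = D * (r⁻¹ * r * r) := by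
          rw [lintegral_const, ← univ_prod_univ, Measure.prod_prod, hμr, hνr]; ring
      _ ≤ D * r := by
          gcongr
          exact mul_le_of_le_one_left' (ENNReal.inv_mul_le_one r)

end Couplings

/-! ### Supports, radii and the constants on a ball -/

section Supports

variable {d : ℕ} {V : Prob (Pos d) → Prob (TPos d)}

lemma support_subset_closedBall {μ : Measure (Pos d)} {R : ℝ} (h : ∀ᵐ x ∂μ, ‖x‖ ≤ R) :
    μ.support ⊆ Metric.closedBall 0 R :=
  Measure.support_subset_of_isClosed Metric.isClosed_closedBall
    (by filter_upwards [h] with x hx; simpa using hx)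

lemma compSupp_of_ae_norm_le {μ : Prob (Pos d)} {R : ℝ}
    (h : ∀ᵐ x ∂(μ : Measure (Pos d)), ‖x‖ ≤ R) : CompSupp μ :=
  (isCompact_closedBall (0 : Pos d) R).of_isClosed_subset Measure.isClosed_support
    (support_subset_closedBall h)

lemma CompSupp.exists_ae_norm_le {μ : Prob (Pos d)} (h : CompSupp μ) :
    ∃ R : ℝ, 0 ≤ R ∧ ∀ᵐ x ∂(μ : Measure (Pos d)), ‖x‖ ≤ R := by
  obtain ⟨R, hR⟩ := h.isBounded.subset_closedBall 0
  refine ⟨max R 0, le_max_right _ _, ?_⟩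
  filter_upwards [Measure.support_mem_ae (μ := (μ : Measure (Pos d)))] with x hx
  exact le_max_of_le_left (by simpa using hR hx)

lemma integrable_of_ae_norm_le {f : Pos d → ℝ} (hf : Continuous f) {μ : Measure (Pos d)}
    [IsFiniteMeasure μ] {R : ℝ} (h : ∀ᵐ x ∂μ, ‖x‖ ≤ R) : Integrable f μ := by
  obtain ⟨B, hB⟩ := (isCompact_closedBall (0 : Pos d) R).exists_bound_of_continuousOn
    hf.continuousOn
  refine Integrable.of_bound hf.aestronglyMeasurable B ?_
  filter_upwards [h] with x hx
  exact hB x (by simpa using hx)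

lemma abs_le_of_enorm_le {a b : ℝ} (hb : 0 ≤ b) (h : ‖a‖ₑ ≤ ENNReal.ofReal b) : |a| ≤ b := by
  rwa [Real.enorm_eq_ofReal_abs, ENNReal.ofReal_le_ofReal_iff hb] at h

lemma ae_fst_of_ae (hV : IsPVF V) {μ : Prob (Pos d)} {p : Pos d → Prop}
    (h : ∀ᵐ x ∂(μ : Measure (Pos d)), p x) : ∀ᵐ q ∂(V μ : Measure (TPos d)), p q.1 := by
  rw [← hV μ] at h
  exact ae_of_ae_map measurable_fst.aemeasurable h

/-- A probability vector field with velocities bounded by `M` and Lipschitz constant `L` on the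
measures that live in the ball of radius `R`. -/
structure ControlledOn (V : Prob (Pos d) → Prob (TPos d)) (R : ℝ) (M L : ℝ≥0) : Prop where
  isPVF : IsPVF V
  lip_pos : L ≠ 0
  velocity_le : ∀ μ : Prob (Pos d), (∀ᵐ x ∂(μ : Measure (Pos d)), ‖x‖ ≤ R) →
    ∀ᵐ p ∂(V μ : Measure (TPos d)), ‖p.2‖ ≤ M
  fiberW_le : ∀ μ ν : Prob (Pos d), (∀ᵐ x ∂(μ : Measure (Pos d)), ‖x‖ ≤ R) →
    (∀ᵐ x ∂(ν : Measure (Pos d)), ‖x‖ ≤ R) →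
    fiberW (V μ : Measure (TPos d)) (V ν : Measure (TPos d)) ≤ L * W1 (μ : Measure (Pos d)) ν

/-- Linear growth of the velocities, in terms of radii. -/
def VelocityGrowth (V : Prob (Pos d) → Prob (TPos d)) (C : ℝ) : Prop :=
  ∀ (μ : Prob (Pos d)) (R : ℝ), 0 ≤ R → (∀ᵐ x ∂(μ : Measure (Pos d)), ‖x‖ ≤ R) →
    ∀ᵐ p ∂(V μ : Measure (TPos d)), ‖p.2‖ ≤ C * (1 + R)

lemma Sublinear.exists_velocityGrowth (h : Sublinear V) : ∃ C : ℝ, 0 < C ∧ VelocityGrowth V C := by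
  obtain ⟨C, hC, H⟩ := h
  refine ⟨C, hC, fun μ R hR hμ => ?_⟩
  filter_upwards [Measure.support_mem_ae (μ := (V μ : Measure (TPos d)))] with p hp
  refine (H μ (compSupp_of_ae_norm_le hμ) p hp).trans ?_
  gcongr
  refine Real.sSup_le ?_ hR
  rintro _ ⟨x, hx, rfl⟩
  simpa using support_subset_closedBall hμ hx

lemma exists_controlledOn (hV : IsPVF V) {C : ℝ} (hC : 0 ≤ C) (hs : VelocityGrowth V C)
    (hl : LocLip V) {R : ℝ} (hR : 0 ≤ R) : ∃ M L : ℝ≥0, ControlledOn V R M L := by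
  -- `LocLip` speaks of open balls, the bound `‖x‖ ≤ R` of a closed one.
  obtain ⟨L, hL, H⟩ := hl (R + 1) (by linarith)
  refine ⟨⟨C * (1 + R), by positivity⟩, L, hV, hL.ne', fun μ hμ => hs μ R hR hμ,
    fun μ ν hμ hν => H μ ν (compSupp_of_ae_norm_le hμ) (compSupp_of_ae_norm_le hν) ?_ ?_⟩
  · exact (support_subset_closedBall hμ).trans (Metric.closedBall_subset_ball (by linarith))
  · exact (support_subset_closedBall hν).trans (Metric.closedBall_subset_ball (by linarith))

end Supports

/-! ### Estimates along Euler curves -/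

section EulerCurves

variable {d : ℕ} {V : Prob (Pos d) → Prob (TPos d)}

lemma lagStep_toMeasure (s : ℝ) (μ : Prob (Pos d)) :
    (lagStep V s μ : Measure (Pos d)) =
      (V μ : Measure (TPos d)).map fun p : TPos d => p.1 + s • p.2 := rfl

lemma lagStep_zero (hV : IsPVF V) (μ : Prob (Pos d)) : lagStep V 0 μ = μ := by
  apply Subtype.ext
  change (lagStep V 0 μ : Measure (Pos d)) = μ
  rw [lagStep_toMeasure, ← hV μ]
  simp

lemma W1_lagStep_le {μ : Prob (Pos d)} {M : ℝ≥0}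
    (h : ∀ᵐ p ∂(V μ : Measure (TPos d)), ‖p.2‖ ≤ M) (s t : ℝ) :
    W1 (lagStep V s μ : Measure (Pos d)) (lagStep V t μ) ≤ ENNReal.ofReal (M * |s - t|) := by
  rw [lagStep_toMeasure, lagStep_toMeasure]
  refine (W1_map_le _ (by fun_prop) (by fun_prop)).trans ?_
  calc _ ≤ ∫⁻ _, ENNReal.ofReal (M * |s - t|) ∂(V μ : Measure (TPos d)) := by
        refine lintegral_mono_ae ?_
        filter_upwards [h] with p hp
        rw [edist_dist, dist_eq_norm]
        gcongr
        rw [add_sub_add_left_eq_sub, ← sub_smul, norm_smul, Real.norm_eq_abs, mul_comm]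
        gcongr
    _ = _ := by simp

/-- Local Lipschitz bounds on the cells of a grid add up. -/
lemma abs_sub_le_of_forall_cell {g : ℝ → ℝ} {τ K a b : ℝ} {N : ℕ}
    (h : ∀ k < N, ∀ x ∈ Icc a b, ∀ y ∈ Icc a b, k * τ ≤ x → x ≤ y → y ≤ (k + 1) * τ →
      |g y - g x| ≤ K * (y - x))
    {s t : ℝ} (hs : 0 ≤ s) (has : a ≤ s) (hst : s ≤ t) (htb : t ≤ b) (ht : t ≤ N * τ) :
    |g t - g s| ≤ K * (t - s) := by
  induction N generalizing t with
  | zero =>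
    have : t = s := by simp at ht; linarith
    simp [this]
  | succ k ih =>
    push_cast at ht
    have ih' := fun t => ih (t := t) fun j hj => h j (hj.trans (Nat.lt_succ_self k))
    rcases le_total t (k * τ) with h1 | h1
    · exact ih' t hst htb h1
    · rcases le_total s (k * τ) with h2 | h2
      · have e1 := ih' (k * τ) h2 (h1.trans htb) le_rfl
        have e2 := h k (Nat.lt_succ_self k) (k * τ) ⟨by linarith, by linarith⟩ t
          ⟨by linarith, htb⟩ le_rfl h1 ht
        calc |g t - g s| ≤ |g t - g (k * τ)| + |g (k * τ) - g s| := abs_sub_le _ _ _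
          _ ≤ K * (t - s) := by linarith
      · exact h k (Nat.lt_succ_self k) s ⟨has, by linarith⟩ t ⟨by linarith, htb⟩ h2 hst ht

/-- A curve that follows the explicit Euler scheme with step `τ` on `[0, N τ]`, within the ball of
radius `R`. -/
structure IsEulerCurve (V : Prob (Pos d) → Prob (TPos d)) (τ : ℝ) (N : ℕ) (R : ℝ)
    (c : ℝ → Prob (Pos d)) : Prop where
  step_nonneg : 0 ≤ τ
  step : ∀ k < N, ∀ t ∈ Icc (k * τ) ((k + 1) * τ), c t = lagStep V (t - k * τ) (c (k * τ))
  norm_le : ∀ t ∈ Icc 0 (N * τ), ∀ᵐ x ∂(c t : Measure (Pos d)), ‖x‖ ≤ R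

namespace IsEulerCurve

variable {τ R : ℝ} {N : ℕ} {c : ℝ → Prob (Pos d)} {M L : ℝ≥0}

lemma mem_Icc_of_cell (hc : IsEulerCurve V τ N R c) {k : ℕ} (hk : k < N) {x : ℝ}
    (hx : x ∈ Icc (k * τ) ((k + 1) * τ)) : x ∈ Icc 0 (N * τ) := by
  have := hc.step_nonneg
  refine ⟨le_trans (by positivity) hx.1, hx.2.trans ?_⟩
  gcongr
  exact_mod_cast hk

lemma left_mem_cell (hc : IsEulerCurve V τ N R c) (k : ℕ) :
    (k * τ : ℝ) ∈ Icc (k * τ) ((k + 1) * τ) :=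
  ⟨le_rfl, by nlinarith [hc.step_nonneg]⟩

lemma velocity_le (hc : IsEulerCurve V τ N R c) (hVc : ControlledOn V R M L) {t : ℝ}
    (ht : t ∈ Icc 0 (N * τ)) : ∀ᵐ p ∂(V (c t) : Measure (TPos d)), ‖p.2‖ ≤ M :=
  hVc.velocity_le _ (hc.norm_le t ht)

lemma W1_le_of_cell (hc : IsEulerCurve V τ N R c) (hVc : ControlledOn V R M L) {k : ℕ}
    (hk : k < N) {x y : ℝ} (hx : x ∈ Icc (k * τ) ((k + 1) * τ))
    (hy : y ∈ Icc (k * τ) ((k + 1) * τ)) (hxy : x ≤ y) :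
    W1 (c y : Measure (Pos d)) (c x) ≤ ENNReal.ofReal (M * (y - x)) := by
  rw [hc.step k hk x hx, hc.step k hk y hy]
  refine (W1_lagStep_le (hc.velocity_le hVc (hc.mem_Icc_of_cell hk (hc.left_mem_cell k))) _ _).trans
    (le_of_eq ?_)
  rw [sub_sub_sub_cancel_right, abs_of_nonneg (sub_nonneg.2 hxy)]

/-- The `W1` bound is known inside a single cell; it is turned into a bound on integrals before
summing over the cells. -/
lemma abs_integral_sub_le (hc : IsEulerCurve V τ N R c) (hVc : ControlledOn V R M L)
    {f : Pos d → ℝ} {K : ℝ≥0} (hK : K ≠ 0) (hf : LipschitzWith K f) {s t : ℝ} (hs : 0 ≤ s)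
    (hst : s ≤ t) (ht : t ≤ N * τ) :
    |∫ x, f x ∂(c t : Measure (Pos d)) - ∫ x, f x ∂(c s : Measure (Pos d))| ≤
      K * M * (t - s) := by
  refine abs_sub_le_of_forall_cell (g := fun t => ∫ x, f x ∂(c t : Measure (Pos d)))
    (fun k hk x _ y _ hx hxy hy => ?_) hs le_rfl hst le_rfl ht
  have hxk : x ∈ Icc (k * τ) ((k + 1) * τ) := ⟨hx, hxy.trans hy⟩
  have hyk : y ∈ Icc (k * τ) ((k + 1) * τ) := ⟨hx.trans hxy, hy⟩
  have hyx : 0 ≤ y - x := sub_nonneg.2 hxy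
  refine abs_le_of_enorm_le (by positivity) ((enorm_integral_sub_le_W1 hK hf
    (integrable_of_ae_norm_le hf.continuous (hc.norm_le y (hc.mem_Icc_of_cell hk hyk)))
    (integrable_of_ae_norm_le hf.continuous (hc.norm_le x (hc.mem_Icc_of_cell hk hxk)))).trans ?_)
  refine (mul_le_mul_right (hc.W1_le_of_cell hVc hk hxk hyk hxy) _).trans (le_of_eq ?_)
  rw [← ENNReal.ofReal_coe_nnreal, ← ENNReal.ofReal_mul (by positivity), mul_assoc]

end IsEulerCurve

lemma ControlledOn.enorm_drift_sub_le {R : ℝ} {M L : ℝ≥0} (hVc : ControlledOn V R M L)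
    {f : Pos d → ℝ} {A K : ℝ≥0} (hK : K ≠ 0) (hA : LipschitzWith A (fderiv ℝ f))
    (hf : LipschitzWith K f) {μ ν : Prob (Pos d)}
    (hμ : ∀ᵐ x ∂(μ : Measure (Pos d)), ‖x‖ ≤ R) (hν : ∀ᵐ x ∂(ν : Measure (Pos d)), ‖x‖ ≤ R) :
    ‖drift f (V μ : Measure (TPos d)) - drift f (V ν : Measure (TPos d))‖ₑ ≤
      (A * M + K * L : ℝ≥0) * W1 (μ : Measure (Pos d)) ν := by
  refine (MDE.enorm_drift_sub_le hK hA (fun x => norm_fderiv_le_of_lipschitz ℝ hf)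
    (hVc.velocity_le μ hμ) (hVc.velocity_le ν hν)).trans ?_
  rw [hVc.isPVF, hVc.isPVF]
  push_cast
  rw [add_mul, mul_assoc (K : ℝ≥0∞)]
  gcongr
  exact hVc.fiberW_le μ ν hμ hν

namespace IsEulerCurve

variable {τ R : ℝ} {N : ℕ} {c : ℝ → Prob (Pos d)} {M L : ℝ≥0}

lemma abs_drift_sub_le (hc : IsEulerCurve V τ N R c) (hVc : ControlledOn V R M L)
    {f : Pos d → ℝ} {A K : ℝ≥0} (hK : K ≠ 0) (hA : LipschitzWith A (fderiv ℝ f))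
    (hf : LipschitzWith K f) {s t : ℝ} (hs : 0 ≤ s) (hst : s ≤ t) (ht : t ≤ N * τ) :
    |drift f (V (c t) : Measure (TPos d)) - drift f (V (c s) : Measure (TPos d))| ≤
      (A * M + K * L : ℝ≥0) * M * (t - s) := by
  refine abs_sub_le_of_forall_cell (g := fun t => drift f (V (c t) : Measure (TPos d)))
    (fun k hk x _ y _ hx hxy hy => ?_) hs le_rfl hst le_rfl ht
  have hxk : x ∈ Icc (k * τ) ((k + 1) * τ) := ⟨hx, hxy.trans hy⟩
  have hyk : y ∈ Icc (k * τ) ((k + 1) * τ) := ⟨hx.trans hxy, hy⟩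
  have hyx : 0 ≤ y - x := sub_nonneg.2 hxy
  refine abs_le_of_enorm_le (by positivity) ((hVc.enorm_drift_sub_le hK hA hf
    (hc.norm_le y (hc.mem_Icc_of_cell hk hyk)) (hc.norm_le x (hc.mem_Icc_of_cell hk hxk))).trans ?_)
  refine (mul_le_mul_right (hc.W1_le_of_cell hVc hk hxk hyk hxy) _).trans (le_of_eq ?_)
  rw [← ENNReal.ofReal_coe_nnreal, ← ENNReal.ofReal_mul (by positivity), mul_assoc]

/-- Consistency of the scheme. One error comes from freezing `∇f` at the start of a particle path,
of length at most `M τ` in a cell; the other from replacing the drift at the node `k τ` by the drift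
at `s`, the two times being at most `t - s + τ` apart. -/
lemma abs_integral_sub_sub_drift_le (hc : IsEulerCurve V τ N R c) (hVc : ControlledOn V R M L)
    {f : Pos d → ℝ} {A K : ℝ≥0} (hK : K ≠ 0) (hA : LipschitzWith A (fderiv ℝ f))
    (hf : LipschitzWith K f) (hfd : Differentiable ℝ f) {s t : ℝ} (hs : 0 ≤ s) (hst : s ≤ t)
    (ht : t ≤ N * τ) :
    |∫ x, f x ∂(c t : Measure (Pos d)) - ∫ x, f x ∂(c s : Measure (Pos d)) -
        (t - s) * drift f (V (c s) : Measure (TPos d))| ≤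
      (A * (M * τ) * M + (A * M + K * L : ℝ≥0) * M * (t - s + τ)) * (t - s) := by
  have hτ := hc.step_nonneg
  set E := drift f (V (c s) : Measure (TPos d)) with hE
  -- Subtracting the linear function `t * E` reduces the claim to increments inside one cell.
  have key := abs_sub_le_of_forall_cell
    (g := fun t => ∫ x, f x ∂(c t : Measure (Pos d)) - t * E)
    (a := s) (b := t) (τ := τ) (N := N)
    (K := A * (M * τ) * M + (A * M + K * L : ℝ≥0) * M * (t - s + τ)) ?_ hs le_rfl hst le_rfl ht
  · refine le_trans (le_of_eq ?_) key
    congr 1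
    ring
  intro k hk x hxs y hys hx hxy hy
  have hxk : x ∈ Icc (k * τ) ((k + 1) * τ) := ⟨hx, hxy.trans hy⟩
  have hyk : y ∈ Icc (k * τ) ((k + 1) * τ) := ⟨hx.trans hxy, hy⟩
  have hyx : 0 ≤ y - x := sub_nonneg.2 hxy
  have hkN := hc.mem_Icc_of_cell hk (hc.left_mem_cell k)
  have hvel := hc.velocity_le hVc hkN
  set m := c (k * τ) with hm
  set P : Measure (TPos d) := (V m : Measure (TPos d)) with hP
  have hint : ∀ z ∈ Icc (k * τ) ((k + 1) * τ),
      ∫ x, f x ∂(c z : Measure (Pos d)) = ∫ p, f (p.1 + (z - k * τ) • p.2) ∂P ∧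
      Integrable (fun p : TPos d => f (p.1 + (z - k * τ) • p.2)) P := by
    intro z hz
    have hi := integrable_of_ae_norm_le hf.continuous (hc.norm_le z (hc.mem_Icc_of_cell hk hz))
    rw [hc.step k hk z hz, lagStep_toMeasure] at hi ⊢
    refine ⟨integral_map (by fun_prop) hf.continuous.aestronglyMeasurable, ?_⟩
    exact hi.comp_measurable (by fun_prop)
  have hdi : Integrable (fun p : TPos d => fderiv ℝ f p.1 p.2) P :=
    integrable_fderiv_apply hA.continuous (fun x => norm_fderiv_le_of_lipschitz ℝ hf) hvel
  have h1 : |∫ x, f x ∂(c y : Measure (Pos d)) - ∫ x, f x ∂(c x : Measure (Pos d)) -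
      (y - x) * drift f P| ≤ A * (M * τ) * M * (y - x) := by
    have h := norm_integral_le_of_norm_le_const (μ := P) (C := A * (M * τ) * M * (y - x))
      (f := fun p : TPos d => f (p.1 + (y - k * τ) • p.2) - f (p.1 + (x - k * τ) • p.2) -
        (y - x) * fderiv ℝ f p.1 p.2) ?_
    · have hi : Integrable (fun p : TPos d => f (p.1 + (y - k * τ) • p.2) -
          f (p.1 + (x - k * τ) • p.2)) P := (hint y hyk).2.sub (hint x hxk).2
      rw [integral_sub hi (hdi.const_mul _), integral_sub (hint y hyk).2 (hint x hxk).2, integral_const_mul, ← (hint y hyk).1,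
        ← (hint x hxk).1] at h
      simpa [drift] using h
    filter_upwards [hvel] with p hp
    have hmem : ∀ z ∈ Icc (k * τ) ((k + 1) * τ),
        p.1 + (z - k * τ) • p.2 ∈ Metric.closedBall p.1 (M * τ) := by
      intro z hz
      rw [mem_closedBall_iff_norm, add_sub_cancel_left, norm_smul, Real.norm_eq_abs,
        abs_of_nonneg (sub_nonneg.2 hz.1), mul_comm]
      have : z - k * τ ≤ τ := by linarith [hz.2]
      have := sub_nonneg.2 hz.1
      gcongr
    -- Mean value inequality for `f` minus its linearisation at `p.1`: on this ball `∇f` varies by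
    -- at most `A M τ`.
    have hmv := (convex_closedBall p.1 (M * τ)).norm_image_sub_le_of_norm_hasFDerivWithin_le'
      (f := f) (f' := fderiv ℝ f) (φ := fderiv ℝ f p.1) (C := A * (M * τ))
      (fun q _ => (hfd q).hasFDerivAt.hasFDerivWithinAt)
      (fun q hq => (hA.norm_sub_le q p.1).trans (by gcongr; exact mem_closedBall_iff_norm.1 hq))
      (hmem x hxk) (hmem y hyk)
    have e : p.1 + (y - k * τ) • p.2 - (p.1 + (x - k * τ) • p.2) = (y - x) • p.2 := by
      rw [add_sub_add_left_eq_sub, ← sub_smul, sub_sub_sub_cancel_right]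
    rw [e, map_smul, smul_eq_mul, norm_smul, Real.norm_of_nonneg hyx] at hmv
    refine hmv.trans ?_
    rw [mul_comm (y - x), ← mul_assoc]
    gcongr
  have h2 : |drift f P - E| ≤ (A * M + K * L : ℝ≥0) * M * (t - s + τ) := by
    -- If `s` is interior to the cell, the node precedes it by at most `τ`; hence the extra `τ` in
    -- the bound.
    rcases le_total s (k * τ) with h | h
    · refine (hc.abs_drift_sub_le hVc hK hA hf hs h hkN.2).trans ?_
      have : k * τ ≤ t := hx.trans (hxy.trans hys.2)
      gcongr
      linarith
    · rw [abs_sub_comm]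
      refine (hc.abs_drift_sub_le hVc hK hA hf hkN.1 h (hst.trans ht)).trans ?_
      have : s ≤ (k + 1) * τ := hxs.1.trans (hxy.trans hy)
      gcongr
      linarith
  calc |∫ z, f z ∂(c y : Measure (Pos d)) - y * E - (∫ z, f z ∂(c x : Measure (Pos d)) - x * E)|
      = |(∫ z, f z ∂(c y : Measure (Pos d)) - ∫ z, f z ∂(c x : Measure (Pos d)) -
          (y - x) * drift f P) + (y - x) * (drift f P - E)| := by congr 1; ring
    _ ≤ A * (M * τ) * M * (y - x) + (y - x) * ((A * M + K * L : ℝ≥0) * M * (t - s + τ)) := by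
        refine (abs_add_le _ _).trans (add_le_add h1 ?_)
        rw [abs_mul, abs_of_nonneg hyx]
        gcongr
    _ = _ := by ring

end IsEulerCurve

end EulerCurves

/-! ### What survives in `W1` limits -/

section Limits

variable {d : ℕ} {V : Prob (Pos d) → Prob (TPos d)}

lemma tendsto_of_enorm_sub_le {ι : Type*} {l : Filter ι} {a : ι → ℝ} {b : ℝ} {w : ι → ℝ≥0∞}
    {K : ℝ≥0} (hw : Tendsto w l (𝓝 0)) (h : ∀ᶠ i in l, ‖a i - b‖ₑ ≤ K * w i) :
    Tendsto a l (𝓝 b) := by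
  rw [tendsto_iff_edist_tendsto_0]
  have hKw : Tendsto (fun i => (K : ℝ≥0∞) * w i) l (𝓝 0) := by
    simpa using ENNReal.Tendsto.const_mul hw (Or.inr ENNReal.coe_ne_top)
  refine tendsto_of_tendsto_of_tendsto_of_le_of_le' tendsto_const_nhds hKw
    (Eventually.of_forall fun _ => zero_le) ?_
  filter_upwards [h] with i hi
  rwa [edist_eq_enorm_sub]

lemma tendsto_integral_of_tendsto_W1 {ι : Type*} {l : Filter ι} {m : ι → Measure (Pos d)}
    {μ : Measure (Pos d)} {f : Pos d → ℝ} {K : ℝ≥0} (hf : LipschitzWith K f)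
    (hm : ∀ᶠ i in l, Integrable f (m i)) (hμ : Integrable f μ)
    (h : Tendsto (fun i => W1 (m i) μ) l (𝓝 0)) :
    Tendsto (fun i => ∫ x, f x ∂(m i)) l (𝓝 (∫ x, f x ∂μ)) := by
  -- `K + 1` because the duality bound asks for a nonzero constant.
  refine tendsto_of_enorm_sub_le (K := K + 1) h ?_
  filter_upwards [hm] with i hi
  exact enorm_integral_sub_le_W1 (by positivity) (hf.weaken (by simp)) hi hμ

lemma integrable_of_lipschitz_of_bounded {f : Pos d → ℝ} {K : ℝ≥0} (hf : LipschitzWith K f)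
    (hb : ∃ C, ∀ x y, dist (f x) (f y) ≤ C) (μ : Measure (Pos d)) [IsFiniteMeasure μ] :
    Integrable f μ := by
  obtain ⟨C, hC⟩ := hb
  refine Integrable.of_bound hf.continuous.aestronglyMeasurable (C + ‖f 0‖)
    (Eventually.of_forall fun x => ?_)
  have h1 := hC x 0
  rw [dist_eq_norm] at h1
  linarith [norm_le_norm_sub_add (f x) (f 0)]

lemma tendsto_of_tendsto_W1 {ι : Type*} {l : Filter ι} [l.IsCountablyGenerated]
    {m : ι → Prob (Pos d)} {μ : Prob (Pos d)}
    (h : Tendsto (fun i => W1 (m i : Measure (Pos d)) μ) l (𝓝 0)) : Tendsto m l (𝓝 μ) := by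
  rw [tendsto_iff_forall_lipschitz_integral_tendsto]
  rintro f hb ⟨K, hf⟩
  exact tendsto_integral_of_tendsto_W1 hf
    (Eventually.of_forall fun i => integrable_of_lipschitz_of_bounded hf hb _)
    (integrable_of_lipschitz_of_bounded hf hb _) h

/-- Portmanteau: the complement of the closed ball is open, so its limit mass is at most a liminf of
zeros. -/
lemma ae_norm_le_of_tendsto {ι : Type*} {l : Filter ι} [l.NeBot]
    {m : ι → Prob (Pos d)} {μ : Prob (Pos d)} (h : Tendsto m l (𝓝 μ)) {R : ℝ}
    (hm : ∀ᶠ i in l, ∀ᵐ x ∂(m i : Measure (Pos d)), ‖x‖ ≤ R) :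
    ∀ᵐ x ∂(μ : Measure (Pos d)), ‖x‖ ≤ R := by
  have hset : {x : Pos d | ¬ ‖x‖ ≤ R} = (Metric.closedBall 0 R)ᶜ := by ext; simp
  have hG := ProbabilityMeasure.le_liminf_measure_open_of_tendsto h
    (Metric.isClosed_closedBall (x := (0 : Pos d)) (ε := R)).isOpen_compl
  have h0 : (fun i => (m i : Measure (Pos d)) (Metric.closedBall 0 R)ᶜ) =ᶠ[l] fun _ => 0 := by
    filter_upwards [hm] with i hi
    rw [← hset]
    exact hi
  rw [liminf_congr h0, liminf_const, nonpos_iff_eq_zero, ← hset] at hG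
  exact hG

lemma hasDerivAt_of_abs_sub_le_sq {G : ℝ → ℝ} {G' D t : ℝ}
    (h : ∀ᶠ s in 𝓝 t, |G s - G t - (s - t) * G'| ≤ D * (s - t) ^ 2) : HasDerivAt G G' t := by
  rw [hasDerivAt_iff_isLittleO]
  refine Asymptotics.IsBigO.trans_isLittleO (g := fun s => ‖s - t‖ ^ 2) ?_
    (Asymptotics.isLittleO_pow_sub_sub t one_lt_two)
  refine Asymptotics.IsBigO.of_bound D ?_
  filter_upwards [h] with s hs
  simpa using hs

end Limits

/-! ### From quadratic remainders to solutions -/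

section Solutions

variable {d : ℕ} {V : Prob (Pos d) → Prob (TPos d)}

/-- The integrated form of the equation, with quadratic remainder. -/
lemma isSolution_of_quadratic_remainder {R T : ℝ} {M L : ℝ≥0} (hT : 0 < T)
    (hVc : ControlledOn V R M L) {μ₀ : Prob (Pos d)} {μ : ℝ → Prob (Pos d)} (h0 : μ 0 = μ₀)
    (hR : ∀ t ∈ Icc 0 T, ∀ᵐ x ∂(μ t : Measure (Pos d)), ‖x‖ ≤ R)
    (H : ∀ f : Pos d → ℝ, ContDiff ℝ ∞ f → HasCompactSupport f → ∃ D : ℝ≥0,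
      ∀ s t : ℝ, 0 ≤ s → s ≤ t → t ≤ T →
        |∫ x, f x ∂(μ t : Measure (Pos d)) - ∫ x, f x ∂(μ s : Measure (Pos d))| ≤ D * (t - s) ∧
        |drift f (V (μ t) : Measure (TPos d)) - drift f (V (μ s) : Measure (TPos d))| ≤
          D * (t - s) ∧
        |∫ x, f x ∂(μ t : Measure (Pos d)) - ∫ x, f x ∂(μ s : Measure (Pos d)) -
          (t - s) * drift f (V (μ s) : Measure (TPos d))| ≤ D * (t - s) ^ 2) :
    IsSolution V T μ₀ μ := by
  have hlip : ∀ {g : ℝ → ℝ} {D : ℝ≥0},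
      (∀ s t : ℝ, 0 ≤ s → s ≤ t → t ≤ T → |g t - g s| ≤ D * (t - s)) →
      LipschitzOnWith D g (Icc 0 T) := by
    intro g D h
    refine LipschitzOnWith.of_dist_le_mul fun x hx y hy => ?_
    rcases le_total x y with hxy | hxy
    · rw [dist_comm, dist_comm x, Real.dist_eq, Real.dist_eq, abs_of_nonneg (sub_nonneg.2 hxy)]
      exact h x y hx.1 hxy hy.2
    · rw [Real.dist_eq, Real.dist_eq, abs_of_nonneg (sub_nonneg.2 hxy)]
      exact h y x hy.1 hxy hx.2
  refine ⟨h0, ?_, fun f hf hfc => ?_, fun f hf hfc => ?_, ?_⟩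
  · refine (ae_restrict_iff' measurableSet_Icc).2 (Eventually.of_forall fun t ht f hf hfc => ?_)
    obtain ⟨K, hK⟩ := hf.lipschitzWith_of_hasCompactSupport hfc (by simp)
    exact integrable_fderiv_apply (hf.continuous_fderiv (by simp))
      (fun x => norm_fderiv_le_of_lipschitz ℝ hK) (hVc.velocity_le _ (hR t ht))
  · obtain ⟨D, hD⟩ := H f hf hfc
    exact (hlip fun s t hs hst ht => (hD s t hs hst ht).2.1).continuousOn.integrableOn_compact
      isCompact_Icc
  · obtain ⟨D, hD⟩ := H f hf hfc
    refine LipschitzOnWith.absolutelyContinuousOnInterval (K := D) ?_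
    rw [uIcc_of_le hT.le]
    exact hlip fun s t hs hst ht => (hD s t hs hst ht).1
  -- Only the endpoints are discarded, so the null set does not depend on `f`.
  · rw [← restrict_Ioo_eq_restrict_Icc]
    refine (ae_restrict_iff' measurableSet_Ioo).2 (Eventually.of_forall fun t ht f hf hfc => ?_)
    obtain ⟨D, hD⟩ := H f hf hfc
    -- For `s < t` the remainder is centred at `s`; moving the drift from `s` to `t` costs a second
    -- `D (t - s)²`.
    refine hasDerivAt_of_abs_sub_le_sq (D := 2 * D) ?_
    filter_upwards [isOpen_Ioo.mem_nhds ht] with s hs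
    change |_ - _ - (s - t) * drift f (V (μ t) : Measure (TPos d))| ≤ _
    have hD0 : (0 : ℝ) ≤ D := D.2
    rcases le_total t s with hts | hts
    · refine ((hD t s ht.1.le hts hs.2.le).2.2).trans ?_
      nlinarith [sq_nonneg (s - t), mul_nonneg hD0 (sq_nonneg (s - t))]
    · obtain ⟨-, h2, h3⟩ := hD s t hs.1.le hts ht.2.le
      have hts' : 0 ≤ t - s := sub_nonneg.2 hts
      set F := drift f (V (μ t) : Measure (TPos d))
      set E := drift f (V (μ s) : Measure (TPos d))
      set a := ∫ x, f x ∂(μ t : Measure (Pos d))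
      set b := ∫ x, f x ∂(μ s : Measure (Pos d))
      calc |b - a - (s - t) * F| = |-(a - b - (t - s) * E) + (t - s) * (F - E)| := by
            congr 1; ring
        _ ≤ |a - b - (t - s) * E| + (t - s) * |F - E| := by
            refine (abs_add_le _ _).trans (le_of_eq ?_)
            rw [abs_neg, abs_mul, abs_of_nonneg hts']
        _ ≤ D * (t - s) ^ 2 + (t - s) * (D * (t - s)) := by gcongr
        _ = 2 * D * (s - t) ^ 2 := by ring

/-- Limits of Euler curves with vanishing step are solutions. -/
theorem isSolution_of_tendsto_W1 {R T : ℝ} {M L : ℝ≥0} (hT : 0 < T)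
    (hVc : ControlledOn V R M L) {μ₀ : Prob (Pos d)} {c : ℕ → ℝ → Prob (Pos d)}
    (hc0 : ∀ n, c n 0 = μ₀) {τ : ℕ → ℝ} {N : ℕ → ℕ} (hτ : Tendsto τ atTop (𝓝 0))
    (hNτ : ∀ᶠ n in atTop, N n * τ n = T)
    (hc : ∀ᶠ n in atTop, IsEulerCurve V (τ n) (N n) R (c n)) {μ : ℝ → Prob (Pos d)}
    (h : ∀ t ∈ Icc 0 T,
      Tendsto (fun n => W1 (c n t : Measure (Pos d)) (μ t : Measure (Pos d))) atTop (𝓝 0)) :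
    (∀ t ∈ Icc 0 T, ∀ᵐ x ∂(μ t : Measure (Pos d)), ‖x‖ ≤ R) ∧ IsSolution V T μ₀ μ := by
  have hcR : ∀ t ∈ Icc 0 T, ∀ᶠ n in atTop, ∀ᵐ x ∂(c n t : Measure (Pos d)), ‖x‖ ≤ R := by
    intro t ht
    filter_upwards [hc, hNτ] with n hn hNn
    exact hn.norm_le t (by rwa [hNn])
  have hR : ∀ t ∈ Icc 0 T, ∀ᵐ x ∂(μ t : Measure (Pos d)), ‖x‖ ≤ R := fun t ht =>
    ae_norm_le_of_tendsto (tendsto_of_tendsto_W1 (h t ht)) (hcR t ht)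
  refine ⟨hR, isSolution_of_quadratic_remainder hT hVc ?_ hR fun f hf hfc => ?_⟩
  · have := tendsto_of_tendsto_W1 (h 0 ⟨le_rfl, hT.le⟩)
    simp only [hc0] at this
    exact tendsto_nhds_unique this tendsto_const_nhds |>.symm ▸ rfl
  obtain ⟨K', hK'⟩ := hf.lipschitzWith_of_hasCompactSupport hfc (by simp)
  obtain ⟨A, hA⟩ := (hf.fderiv_right (m := 1) (by norm_cast)).lipschitzWith_of_hasCompactSupport
    (hfc.fderiv ℝ) one_ne_zero
  have hfd : Differentiable ℝ f := hf.differentiable (by simp)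
  set K := K' + 1 with hKdef
  have hK0 : K ≠ 0 := by positivity
  have hK : LipschitzWith K f := hK'.weaken (by simp [hKdef])
  have hG : ∀ t ∈ Icc 0 T, Tendsto (fun n => ∫ x, f x ∂(c n t : Measure (Pos d))) atTop
      (𝓝 (∫ x, f x ∂(μ t : Measure (Pos d)))) := by
    intro t ht
    refine tendsto_integral_of_tendsto_W1 hK ?_ (integrable_of_ae_norm_le hK.continuous (hR t ht))
      (h t ht)
    filter_upwards [hcR t ht] with n hn
    exact integrable_of_ae_norm_le hK.continuous hn
  have hF : ∀ t ∈ Icc 0 T, Tendsto (fun n => drift f (V (c n t) : Measure (TPos d))) atTop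
      (𝓝 (drift f (V (μ t) : Measure (TPos d)))) := by
    intro t ht
    refine tendsto_of_enorm_sub_le (K := A * M + K * L) (h t ht) ?_
    filter_upwards [hcR t ht] with n hn
    exact hVc.enorm_drift_sub_le hK0 hA hK hn (hR t ht)
  -- `K M` bounds the slope of `∫ f`; `(A M + K L) M` bounds the slope of the drift, and also the
  -- remainder once `τ = 0`.
  refine ⟨K * M + (A * M + K * L) * M, fun s t hs hst ht => ?_⟩
  have hts : 0 ≤ t - s := sub_nonneg.2 hst
  have hsI : s ∈ Icc 0 T := ⟨hs, hst.trans ht⟩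
  have htI : t ∈ Icc 0 T := ⟨hs.trans hst, ht⟩
  refine ⟨?_, ?_, ?_⟩
  · refine (le_of_tendsto ((hG t htI).sub (hG s hsI)).abs (b := K * M * (t - s)) ?_).trans ?_
    · filter_upwards [hc, hNτ] with n hn hNn
      exact hn.abs_integral_sub_le hVc hK0 hK hs hst (by rwa [hNn])
    · push_cast
      gcongr
      simp only [le_add_iff_nonneg_right]
      positivity
  · refine (le_of_tendsto ((hF t htI).sub (hF s hsI)).abs
      (b := (A * M + K * L : ℝ≥0) * M * (t - s)) ?_).trans ?_
    · filter_upwards [hc, hNτ] with n hn hNn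
      exact hn.abs_drift_sub_le hVc hK0 hA hK hs hst (by rwa [hNn])
    · push_cast
      gcongr
      simp only [le_add_iff_nonneg_left]
      positivity
  · have hlim : Tendsto (fun n => (A * (M * τ n) * M +
        (A * M + K * L : ℝ≥0) * M * (t - s + τ n)) * (t - s)) atTop
        (𝓝 ((A * (M * 0) * M + (A * M + K * L : ℝ≥0) * M * (t - s + 0)) * (t - s))) :=
      Tendsto.mul_const _ ((((hτ.const_mul _).const_mul _).mul_const _).add
        ((hτ.const_add _).const_mul _))
    refine (le_of_tendsto_of_tendsto (((hG t htI).sub (hG s hsI)).sub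
      ((hF s hsI).const_mul (t - s))).abs hlim ?_).trans ?_
    · filter_upwards [hc, hNτ] with n hn hNn
      exact hn.abs_integral_sub_sub_drift_le hVc hK0 hA hK hfd hs hst (by rwa [hNn])
    · push_cast
      have : 0 ≤ (K : ℝ) * M * (t - s) ^ 2 := by positivity
      nlinarith

end Solutions

/-! ### Compactness of curves of measures -/

section Compactness

variable {d : ℕ}

/-- Cut both measures into the pieces of density `χ i`. Corresponding pieces lie within `ε` of the
same `y i`, so only the mismatch of masses has to travel far, and then at most `2 R`. -/
lemma W1_le_of_partition {ι : Type*} [Fintype ι] {χ : ι → Pos d → ℝ} {y : ι → Pos d} {ε R : ℝ}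
    (hc : ∀ i, Continuous (χ i)) (h0 : ∀ i x, 0 ≤ χ i x)
    (hs : ∀ i x, χ i x ≠ 0 → dist x (y i) ≤ ε) (h1 : ∀ x, ‖x‖ ≤ R → ∑ i, χ i x = 1)
    {μ ν : Measure (Pos d)} [IsProbabilityMeasure μ] [IsProbabilityMeasure ν]
    (hμ : ∀ᵐ x ∂μ, ‖x‖ ≤ R) (hν : ∀ᵐ x ∂ν, ‖x‖ ≤ R) :
    W1 μ ν ≤ ENNReal.ofReal (2 * ε) +
      ENNReal.ofReal (2 * R) * ∑ i, ENNReal.ofReal (∫ x, χ i x ∂μ - ∫ x, χ i x ∂ν) := by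
  have hmeas : ∀ i, Measurable fun x => ENNReal.ofReal (χ i x) := fun i =>
    (hc i).measurable.ennreal_ofReal
  have hsum : ∀ {μ : Measure (Pos d)}, (∀ᵐ x ∂μ, ‖x‖ ≤ R) →
      ∑ i, μ.withDensity (fun x => ENNReal.ofReal (χ i x)) = μ := by
    intro μ hμ
    ext s hs
    simp only [Measure.coe_finsetSum, Finset.sum_apply, withDensity_apply _ hs]
    rw [← lintegral_finsetSum _ fun i _ => hmeas i]
    calc _ = ∫⁻ _ in s, 1 ∂μ := by
          refine lintegral_congr_ae ?_
          filter_upwards [ae_restrict_of_ae hμ] with x hx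
          rw [← ENNReal.ofReal_sum_of_nonneg fun i _ => h0 i x, h1 x hx, ENNReal.ofReal_one]
      _ = μ s := by simp
  have hball : ∀ {μ : Measure (Pos d)} (i : ι),
      ∀ᵐ x ∂μ.withDensity (fun x => ENNReal.ofReal (χ i x)), dist x (y i) ≤ ε := by
    intro μ i
    rw [ae_withDensity_iff (hmeas i)]
    refine Eventually.of_forall fun x hx => hs i x fun h => hx ?_
    rw [h, ENNReal.ofReal_zero]
  have hmass : ∀ {μ : Measure (Pos d)} [IsProbabilityMeasure μ], (∀ᵐ x ∂μ, ‖x‖ ≤ R) → ∀ i,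
      μ.withDensity (fun x => ENNReal.ofReal (χ i x)) univ = ENNReal.ofReal (∫ x, χ i x ∂μ) := by
    intro μ _ hμ i
    rw [withDensity_apply _ MeasurableSet.univ, Measure.restrict_univ,
      ofReal_integral_eq_lintegral_ofReal (integrable_of_ae_norm_le (hc i) hμ)
        (Eventually.of_forall (h0 i))]
  refine (W1_le_of_sum (hsum hμ) (hsum hν) (ε := ENNReal.ofReal (2 * ε))
    (D := ENNReal.ofReal (2 * R)) (fun i => ?_) ?_).trans (le_of_eq ?_)
  · filter_upwards [Measure.quasiMeasurePreserving_fst.ae (hball (μ := μ) i),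
      Measure.quasiMeasurePreserving_snd.ae (hball (μ := ν) i)] with p hp1 hp2
    rw [edist_dist]
    refine ENNReal.ofReal_le_ofReal ?_
    linarith [dist_triangle_right p.1 p.2 (y i)]
  · filter_upwards [Measure.quasiMeasurePreserving_fst.ae hμ,
      Measure.quasiMeasurePreserving_snd.ae hν] with p hp1 hp2
    rw [edist_dist, dist_eq_norm]
    refine ENNReal.ofReal_le_ofReal ?_
    linarith [norm_sub_le p.1 p.2]
  · congr 2
    refine Finset.sum_congr rfl fun i _ => ?_
    rw [hmass hμ, hmass hν, ENNReal.ofReal_sub _ (integral_nonneg (h0 i))]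

/-- Finitely many test functions control the transport distance in a ball, up to `ε`. -/
lemma exists_testFunctions {R ε : ℝ} (hR : 0 ≤ R) (hε : 0 < ε) :
    ∃ (n : ℕ) (χ : Fin n → Pos d → ℝ) (K : ℝ≥0) (η : ℝ), K ≠ 0 ∧ 0 < η ∧
      (∀ i, LipschitzWith K (χ i)) ∧ (∀ i, HasCompactSupport (χ i)) ∧
      ∀ μ ν : Prob (Pos d), (∀ᵐ x ∂(μ : Measure (Pos d)), ‖x‖ ≤ R) →
        (∀ᵐ x ∂(ν : Measure (Pos d)), ‖x‖ ≤ R) →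
        (∀ i, |∫ x, χ i x ∂(μ : Measure (Pos d)) - ∫ x, χ i x ∂(ν : Measure (Pos d))| ≤ η) →
        W1 (μ : Measure (Pos d)) ν ≤ ENNReal.ofReal ε := by
  obtain ⟨t, -, htf, ht⟩ := finite_cover_balls_of_compact (isCompact_closedBall (0 : Pos d) R)
    (show 0 < ε / 4 by positivity)
  have := htf.to_subtype
  obtain ⟨n, ⟨e⟩⟩ := Finite.exists_equiv_fin t
  obtain ⟨f, hf⟩ := SmoothPartitionOfUnity.exists_isSubordinate (modelWithCornersSelf ℝ (Pos d))
    (Metric.isClosed_closedBall (x := (0 : Pos d)) (ε := R))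
    (fun i : Fin n => Metric.ball ((e.symm i : t) : Pos d) (ε / 4)) (fun _ => Metric.isOpen_ball)
    (by
      intro x hx
      obtain ⟨y, hy, hxy⟩ := mem_iUnion₂.1 (ht hx)
      exact mem_iUnion.2 ⟨e ⟨y, hy⟩, by simpa using hxy⟩)
  have hcs : ∀ i, HasCompactSupport (f i) := fun i =>
    (isCompact_closedBall _ _).of_isClosed_subset (isClosed_tsupport _)
      ((hf i).trans Metric.ball_subset_closedBall)
  have hsm : ∀ i, ContDiff ℝ ∞ (f i) := fun i => (f i).contMDiff.contDiff
  choose K hK using fun i => (hsm i).lipschitzWith_of_hasCompactSupport (hcs i) (by simp)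
  -- With this tolerance, `n` mismatches carried over a distance `2 R` cost at most `ε / 2`; the `+
  -- 1` keeps the denominator positive when `2 R n = 0`.
  have hη : 0 < ε / 2 / (2 * R * n + 1) := by positivity
  refine ⟨n, fun i => f i, ∑ i, K i + 1, ε / 2 / (2 * R * n + 1), by positivity, hη,
    fun i => (hK i).weaken ?_, hcs, fun μ ν hμ hν h => ?_⟩
  · exact (Finset.single_le_sum (f := K) (fun _ _ => zero_le) (Finset.mem_univ i)).trans (by simp)
  refine (W1_le_of_partition (χ := fun i => f i) (y := fun i => ((e.symm i : t) : Pos d))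
    (ε := ε / 4) (fun i => (hsm i).continuous) (fun i x => f.nonneg i x)
    (fun i x hx => (hf i (subset_tsupport _ hx)).le) (fun x hx => ?_) hμ hν).trans ?_
  · rw [← finsum_eq_sum_of_fintype]
    exact f.sum_eq_one (by simpa using hx)
  calc _ ≤ ENNReal.ofReal (2 * (ε / 4)) + ENNReal.ofReal (2 * R) *
        ∑ _i : Fin n, ENNReal.ofReal (ε / 2 / (2 * R * n + 1)) := by
        gcongr with i
        exact (le_abs_self _).trans (h i)
    _ = ENNReal.ofReal (2 * (ε / 4) + 2 * R * (n * (ε / 2 / (2 * R * n + 1)))) := by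
        rw [Finset.sum_const, Finset.card_univ, Fintype.card_fin, nsmul_eq_mul,
          ENNReal.ofReal_add (by positivity) (by positivity), ENNReal.ofReal_mul (by positivity),
          ENNReal.ofReal_mul (by positivity : (0 : ℝ) ≤ 2 * R),
          ENNReal.ofReal_mul (by positivity : (0 : ℝ) ≤ n), ENNReal.ofReal_natCast]
    _ ≤ ENNReal.ofReal ε := by
        refine ENNReal.ofReal_le_ofReal ?_
        have h1 : 2 * R * (n * (ε / 2 / (2 * R * n + 1))) =
            ε / 2 * ((2 * R * n) / (2 * R * n + 1)) := by ring
        have h2 : (2 * R * n) / (2 * R * n + 1) ≤ 1 := by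
          rw [div_le_one (by positivity)]; linarith
        rw [h1]
        nlinarith

/-- Prokhorov's theorem with no mass allowed outside one compact ball. -/
lemma isCompact_setOf_ae_norm_le (R : ℝ) :
    IsCompact {μ : Prob (Pos d) | ∀ᵐ x ∂(μ : Measure (Pos d)), ‖x‖ ≤ R} := by
  have h := isCompact_setOfPred_probabilityMeasure_mass_eq_compl_isCompact_le
    (u := fun _ => 0) (K := fun _ => Metric.closedBall (0 : Pos d) R) tendsto_const_nhds
    (fun _ => isCompact_closedBall _ _) (Or.inl inferInstance)
  convert h using 1
  ext μ
  have hset : {x : Pos d | ¬ ‖x‖ ≤ R} = (Metric.closedBall 0 R)ᶜ := by ext; simp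
  simp [ae_iff, ProbabilityMeasure.null_iff_toMeasure_null, ← hset]

lemma continuous_integral_of_hasCompactSupport {f : Pos d → ℝ} (hf : Continuous f)
    (hfc : HasCompactSupport f) :
    Continuous fun μ : Prob (Pos d) => ∫ x, f x ∂(μ : Measure (Pos d)) := by
  obtain ⟨C, hC⟩ := hfc.exists_bound_of_continuous hf
  exact ProbabilityMeasure.continuous_integral_boundedContinuousFunction
    (BoundedContinuousFunction.ofNormedAddCommGroup f hf C hC)

/-- **Arzelà–Ascoli** for curves of measures in a ball that are equi-Lipschitz in time. -/
theorem exists_subseq_tendsto_iSup_W1 {T R : ℝ} (hR : 0 ≤ R) {M : ℝ≥0}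
    {c : ℕ → ℝ → Prob (Pos d)}
    (hcR : ∀ᶠ n in atTop, ∀ t ∈ Icc 0 T, ∀ᵐ x ∂(c n t : Measure (Pos d)), ‖x‖ ≤ R)
    (hlip : ∀ᶠ n in atTop, ∀ (f : Pos d → ℝ) (K : ℝ≥0), K ≠ 0 → LipschitzWith K f →
      ∀ s t : ℝ, 0 ≤ s → s ≤ t → t ≤ T →
        |∫ x, f x ∂(c n t : Measure (Pos d)) - ∫ x, f x ∂(c n s : Measure (Pos d))| ≤
          K * M * (t - s)) :
    ∃ φ : ℕ → ℕ, StrictMono φ ∧ ∃ μ : ℝ → Prob (Pos d),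
      Tendsto (fun n => ⨆ t ∈ Icc 0 T,
        W1 (c (φ n) t : Measure (Pos d)) (μ t : Measure (Pos d))) atTop (𝓝 0) := by
  set x : ℕ → Icc (0 : ℝ) T → Prob (Pos d) := fun n t => c n t with hx
  -- Tychonoff over the uncountably many times gives a cluster point, not a subsequence. Near `ρ`
  -- only finitely many times and tests can be matched at once; the Lipschitz bounds do the rest.
  obtain ⟨ρ, hρS, hρ⟩ := (isCompact_univ_pi fun _ : Icc (0 : ℝ) T =>
    isCompact_setOf_ae_norm_le (d := d) R).exists_mapClusterPt_of_frequently (l := atTop) (f := x)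
    (Eventually.frequently (hcR.mono fun n hn t _ => hn t t.2))
  have hρR : ∀ t, ∀ᵐ z ∂(ρ t : Measure (Pos d)), ‖z‖ ≤ R := fun t => hρS t (mem_univ t)
  have habs : ∀ {n : ℕ} {K : ℝ≥0} {f : Pos d → ℝ}, (∀ s t : ℝ, 0 ≤ s → s ≤ t → t ≤ T →
        |∫ x, f x ∂(c n t : Measure (Pos d)) - ∫ x, f x ∂(c n s : Measure (Pos d))| ≤
          K * M * (t - s)) → ∀ s t : Icc (0 : ℝ) T,
      |∫ z, f z ∂(x n t : Measure (Pos d)) - ∫ z, f z ∂(x n s : Measure (Pos d))| ≤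
        K * M * dist t s := by
    intro n K f h s t
    rw [Subtype.dist_eq, Real.dist_eq]
    rcases le_total s t with hst | hst
    · rw [abs_of_nonneg (sub_nonneg.2 (Subtype.coe_le_coe.2 hst))]
      exact h s t s.2.1 hst t.2.2
    · rw [abs_sub_comm, abs_sub_comm (t : ℝ), abs_of_nonneg (sub_nonneg.2 (Subtype.coe_le_coe.2 hst))]
      exact h t s t.2.1 hst s.2.2
  have hI : ∀ {f : Pos d → ℝ}, Continuous f → HasCompactSupport f → ∀ t : Icc (0 : ℝ) T,
      Continuous fun σ : Icc (0 : ℝ) T → Prob (Pos d) => ∫ z, f z ∂(σ t : Measure (Pos d)) :=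
    fun hf hfc t => (continuous_integral_of_hasCompactSupport hf hfc).comp (continuous_apply t)
  have hρlip : ∀ (f : Pos d → ℝ) (K : ℝ≥0), K ≠ 0 → LipschitzWith K f → HasCompactSupport f →
      ∀ s t : Icc (0 : ℝ) T,
        |∫ z, f z ∂(ρ t : Measure (Pos d)) - ∫ z, f z ∂(ρ s : Measure (Pos d))| ≤
          K * M * dist t s := by
    intro f K hK hf hfc s t
    -- A violation is an open condition at `ρ`, hence met by some `x n` that obeys the bound.
    by_contra! hlt
    have hopen : ∀ᶠ σ in 𝓝 ρ, K * M * dist t s <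
        |∫ z, f z ∂(σ t : Measure (Pos d)) - ∫ z, f z ∂(σ s : Measure (Pos d))| :=
      (((hI hf.continuous hfc t).sub (hI hf.continuous hfc s)).abs.tendsto ρ).eventually
        (lt_mem_nhds hlt)
    obtain ⟨n, hn1, hn2⟩ := ((hρ.frequently hopen).and_eventually hlip).exists
    exact (habs (hn2 f K hK hf) s t).not_gt hn1
  have hfreq : ∀ ε : ℝ, 0 < ε → ∃ᶠ n in atTop, ∀ t : Icc (0 : ℝ) T,
      W1 (x n t : Measure (Pos d)) (ρ t) ≤ ENNReal.ofReal ε := by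
    intro ε hε
    obtain ⟨m, χ, K, η, hK, hη, hχ, hχc, H⟩ := exists_testFunctions (d := d) hR hε
    -- A time of the finite net within `δ` of `t` costs `η / 3` along `x n` and `η / 3` along `ρ`;
    -- the last third is their discrepancy at that time.
    have hδ : 0 < η / 3 / (K * M + 1) := by positivity
    set δ := η / 3 / (K * M + 1) with hδdef
    have hKδ : K * M * δ ≤ η / 3 := by
      rw [hδdef, mul_div_assoc', div_le_iff₀ (by positivity)]
      nlinarith
    obtain ⟨F, -, hFf, hF⟩ := finite_cover_balls_of_compact
      (isCompact_univ (X := Icc (0 : ℝ) T)) hδ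
    have hnear : ∀ᶠ σ in 𝓝 ρ, ∀ s ∈ F, ∀ i,
        |∫ z, χ i z ∂(σ s : Measure (Pos d)) - ∫ z, χ i z ∂(ρ s : Measure (Pos d))| < η / 3 := by
      refine (eventually_all_finite hFf).2 fun s _ => eventually_all.2 fun i => ?_
      have h1 := ((hI (hχ i).continuous (hχc i) s).sub (continuous_const
        (y := ∫ z, χ i z ∂(ρ s : Measure (Pos d))))).abs.tendsto ρ
      refine h1.eventually (gt_mem_nhds ?_)
      simpa using hη
    refine ((hρ.frequently hnear).and_eventually (hlip.and hcR)).mono ?_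
    rintro n ⟨hn1, hn2, hn3⟩ t
    refine H _ _ (hn3 t t.2) (hρR t) fun i => ?_
    obtain ⟨s, hsF, hts⟩ := mem_iUnion₂.1 (hF (mem_univ t))
    have hts' : K * M * dist t s ≤ η / 3 := le_trans (by gcongr; exact (Metric.mem_ball.1 hts).le) hKδ
    have e1 := abs_le.1 ((habs (hn2 (χ i) K hK (hχ i)) s t).trans hts')
    have e2 := abs_le.1 ((hρlip (χ i) K hK (hχ i) (hχc i) s t).trans hts')
    have e3 := abs_lt.1 (hn1 s hsF i)
    rw [abs_le]
    constructor <;> linarith [e1.1, e1.2, e2.1, e2.2, e3.1, e3.2]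
  -- Uniform closeness holds for infinitely many `n` at each level `1 / (k + 1)`, so a strictly
  -- increasing choice is possible.
  obtain ⟨φ, hφ, hφW⟩ := extraction_forall_of_frequently
    (P := fun k n => ∀ t : Icc (0 : ℝ) T,
      W1 (x n t : Measure (Pos d)) (ρ t) ≤ ENNReal.ofReal (1 / ((k : ℝ) + 1)))
    fun k => hfreq _ (by positivity)
  classical
  refine ⟨φ, hφ, fun t => if h : t ∈ Icc 0 T then ρ ⟨t, h⟩ else c 0 t, ?_⟩
  have hlim : Tendsto (fun k : ℕ => ENNReal.ofReal (1 / ((k : ℝ) + 1))) atTop (𝓝 0) := by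
    simpa using ENNReal.tendsto_ofReal tendsto_one_div_add_atTop_nhds_zero_nat
  refine tendsto_of_tendsto_of_tendsto_of_le_of_le tendsto_const_nhds hlim
    (fun _ => zero_le) fun k => iSup₂_le fun t ht => ?_
  simpa only [dif_pos ht] using hφW k ⟨t, ht⟩

end Compactness

/-! ### The Lagrangian scheme is an Euler curve in a ball -/

section LagrangianScheme

variable {d : ℕ} {V : Prob (Pos d) → Prob (TPos d)}

lemma stepIndex_eq {τ t : ℝ} (hτ : 0 < τ) {k : ℕ} (h1 : k * τ < t) (h2 : t ≤ (k + 1) * τ) :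
    stepIndex τ t = k := by
  have : ⌈t / τ⌉₊ = k + 1 := by
    rw [Nat.ceil_eq_iff (Nat.succ_ne_zero k)]
    refine ⟨?_, ?_⟩
    · rw [lt_div_iff₀ hτ]; simpa using h1
    · rw [div_le_iff₀ hτ]; push_cast; exact h2
  rw [stepIndex, this, Nat.add_sub_cancel]

lemma exists_cell {τ t : ℝ} (hτ : 0 < τ) {N : ℕ} (ht : 0 < t) (htN : t ≤ N * τ) :
    ∃ k < N, k * τ < t ∧ t ≤ (k + 1) * τ := by
  have hpos : 0 < ⌈t / τ⌉₊ := Nat.ceil_pos.2 (by positivity)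
  obtain ⟨k, hk⟩ := Nat.exists_eq_succ_of_ne_zero hpos.ne'
  obtain ⟨h1, h2⟩ := (Nat.ceil_eq_iff (Nat.succ_ne_zero k)).1 hk
  rw [lt_div_iff₀ hτ] at h1
  rw [div_le_iff₀ hτ] at h2
  simp only [Nat.succ_eq_add_one, Nat.add_sub_cancel] at h1
  push_cast at h2
  refine ⟨k, ?_, h1, h2⟩
  have : (k : ℝ) * τ < N * τ := h1.trans_le htN
  exact_mod_cast lt_of_mul_lt_mul_right this hτ.le

lemma lagScheme_of_mem_Ioc {T : ℝ} {μ₀ : Prob (Pos d)} {N : ℕ} (hτ : 0 < T / N) {k : ℕ} {t : ℝ}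
    (h1 : k * (T / N) < t) (h2 : t ≤ (k + 1) * (T / N)) :
    lagScheme V T μ₀ N t = lagStep V (t - k * (T / N)) (lagNode V (T / N) μ₀ k) := by
  have ht : ¬ t ≤ 0 := not_le.2 (lt_of_le_of_lt (by positivity) h1)
  rw [lagScheme, if_neg ht, stepIndex_eq hτ h1 h2]

lemma lagScheme_node {T : ℝ} {μ₀ : Prob (Pos d)} {N : ℕ} (hτ : 0 < T / N) (k : ℕ) :
    lagScheme V T μ₀ N (k * (T / N)) = lagNode V (T / N) μ₀ k := by
  cases k with
  | zero => simp [lagScheme, lagNode]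
  | succ j =>
    rw [lagScheme_of_mem_Ioc hτ (k := j) (by push_cast; nlinarith) (by push_cast; exact le_rfl),
      lagNode]
    congr 1
    push_cast
    ring

/-- At the left end of a cell, where the scheme is defined by the previous cell or the initial
datum, the formula persists because a step of length zero is the identity. -/
lemma lagScheme_of_mem_Icc (hV : IsPVF V) {T : ℝ} {μ₀ : Prob (Pos d)} {N : ℕ} (hτ : 0 < T / N)
    {k : ℕ} {t : ℝ} (ht : t ∈ Icc (k * (T / N)) ((k + 1) * (T / N))) :
    lagScheme V T μ₀ N t = lagStep V (t - k * (T / N)) (lagNode V (T / N) μ₀ k) := by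
  rcases ht.1.eq_or_lt with h | h
  · rw [← h, lagScheme_node hτ, sub_self, lagStep_zero hV]
  · exact lagScheme_of_mem_Ioc hτ h ht.2

/-- One plus the radius is multiplied by `1 + C' s`, so the recursion is geometric. The map `g` is
the identity for the Lagrangian scheme and rounding for the lattice scheme. -/
lemma ae_norm_le_map_step (hV : IsPVF V) {C C' : ℝ} (hs : VelocityGrowth V C) {μ : Prob (Pos d)}
    {r s : ℝ} (hr : 0 ≤ r) (hs0 : 0 ≤ s) (hμ : ∀ᵐ x ∂(μ : Measure (Pos d)), ‖x‖ ≤ r)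
    {g : Pos d → Pos d} (hg : Measurable g) (hgC : ∀ v, ‖v‖ ≤ C * (1 + r) → ‖g v‖ ≤ C' * (1 + r)) :
    ∀ᵐ x ∂((V μ : Measure (TPos d)).map fun p : TPos d => p.1 + s • g p.2),
      ‖x‖ ≤ (1 + r) * (1 + C' * s) - 1 := by
  rw [ae_map_iff (by fun_prop) (measurableSet_le (by fun_prop) (by fun_prop))]
  filter_upwards [ae_fst_of_ae hV hμ, hs μ r hr hμ] with p hp1 hp2
  calc ‖p.1 + s • g p.2‖ ≤ ‖p.1‖ + s * ‖g p.2‖ := by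
        refine (norm_add_le _ _).trans ?_
        rw [norm_smul, Real.norm_of_nonneg hs0]
    _ ≤ r + s * (C' * (1 + r)) := by gcongr; exact hgC _ hp2
    _ = _ := by ring

/-- Since `k < N`, `k` full steps and a partial one grow no more than `N` full steps. This bounds
the radii and, with `r = 0`, the distance between the schemes. -/
lemma growth_le_exp {r C τ T s : ℝ} {N k : ℕ} (hr : 0 ≤ r) (hC : 0 ≤ C) (hτ : 0 ≤ τ)
    (hN : N * τ = T) (hk : k < N) (hs : s ≤ τ) :
    (1 + r) * (1 + C * τ) ^ k * (1 + C * s) ≤ (1 + r) * Real.exp (C * T) := by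
  rw [mul_assoc]
  gcongr
  calc (1 + C * τ) ^ k * (1 + C * s) ≤ (1 + C * τ) ^ k * (1 + C * τ) := by gcongr
    _ = (1 + C * τ) ^ (k + 1) := (pow_succ _ _).symm
    _ ≤ (1 + C * τ) ^ N := pow_le_pow_right₀ (by nlinarith [mul_nonneg hC hτ]) hk
    _ ≤ Real.exp (C * τ) ^ N := by
        gcongr
        linarith [Real.add_one_le_exp (C * τ)]
    _ = Real.exp (C * T) := by rw [← Real.exp_nat_mul, ← hN]; ring_nf

lemma ae_norm_le_lagNode (hV : IsPVF V) {C : ℝ} (hC : 0 ≤ C) (hs : VelocityGrowth V C)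
    {μ₀ : Prob (Pos d)} {r τ : ℝ} (hr : 0 ≤ r) (hτ : 0 ≤ τ)
    (hμ : ∀ᵐ x ∂(μ₀ : Measure (Pos d)), ‖x‖ ≤ r) (k : ℕ) :
    ∀ᵐ x ∂(lagNode V τ μ₀ k : Measure (Pos d)), ‖x‖ ≤ (1 + r) * (1 + C * τ) ^ k - 1 := by
  induction k with
  | zero => simpa [lagNode] using hμ
  | succ k ih =>
    have h1 : 1 ≤ (1 + C * τ) ^ k := one_le_pow₀ (by nlinarith [mul_nonneg hC hτ])
    have := ae_norm_le_map_step hV hs (by nlinarith) hτ ih measurable_id (C' := C) fun v hv => hv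
    rw [add_sub_cancel, mul_assoc, ← pow_succ] at this
    exact this

lemma isEulerCurve_lagScheme (hV : IsPVF V) {C : ℝ} (hC : 0 ≤ C) (hs : VelocityGrowth V C)
    {μ₀ : Prob (Pos d)} {r T : ℝ} (hr : 0 ≤ r) (hT : 0 < T)
    (hμ : ∀ᵐ x ∂(μ₀ : Measure (Pos d)), ‖x‖ ≤ r) {N : ℕ} (hN : 0 < N) :
    IsEulerCurve V (T / N) N ((1 + r) * Real.exp (C * T)) (lagScheme V T μ₀ N) := by
  have hN' : (0 : ℝ) < N := by exact_mod_cast hN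
  have hτ : 0 < T / N := by positivity
  have hNτ : N * (T / N) = T := by field_simp
  refine ⟨hτ.le, fun k _ t ht => ?_, fun t ht => ?_⟩
  · rw [lagScheme_node hτ, lagScheme_of_mem_Icc hV hτ ht]
  rcases ht.1.eq_or_lt with h0 | h0
  · have := ae_norm_le_lagNode hV hC hs hr hτ.le hμ 0
    rw [← lagScheme_node hτ (T := T), Nat.cast_zero, zero_mul, h0] at this
    filter_upwards [this] with x hx
    have : 1 ≤ Real.exp (C * T) := Real.one_le_exp (by positivity)
    simp only [pow_zero] at hx
    nlinarith
  · obtain ⟨k, hk, h1, h2⟩ := exists_cell hτ h0 ht.2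
    rw [lagScheme_of_mem_Ioc hτ h1 h2]
    have hone : 1 ≤ (1 + C * (T / N)) ^ k := one_le_pow₀ (by nlinarith [mul_nonneg hC hτ.le])
    have := ae_norm_le_map_step hV hs (by nlinarith) (s := t - k * (T / N)) (by linarith)
      (ae_norm_le_lagNode hV hC hs hr hτ.le hμ k) measurable_id (C' := C) fun v hv => hv
    rw [add_sub_cancel] at this
    rw [lagStep_toMeasure]
    filter_upwards [this] with x hx
    linarith [growth_le_exp hr hC hτ.le hNτ hk (s := t - k * (T / N)) (by linarith)]

end LagrangianScheme

/-! ### Discretization as rounding to the lattice -/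

section Lattice

variable {d : ℕ}

/-- The index of the lattice cube that contains a point. -/
noncomputable def cubeIndex (h : ℝ) (x : Pos d) : Fin d → ℤ := fun l => ⌊x l / h⌋

/-- Rounding down to the lattice `h ℤ^d`. -/
noncomputable def gridFloor (h : ℝ) (x : Pos d) : Pos d := latticePt h (cubeIndex h x)

lemma mem_cube_latticePt_iff {h : ℝ} (hh : 0 < h) {x : Pos d} {i : Fin d → ℤ} :
    x ∈ cube h (latticePt h i) ↔ cubeIndex h x = i := by
  simp only [cube, latticePt, mem_ofPred_eq, funext_iff, cubeIndex, Int.floor_eq_iff]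
  refine forall_congr' fun l => ?_
  rw [le_div_iff₀ hh, div_lt_iff₀ hh, mul_comm h, add_mul, one_mul]

lemma latticePt_injective {h : ℝ} (hh : 0 < h) :
    Function.Injective (latticePt h : (Fin d → ℤ) → Pos d) := by
  intro i j hij
  funext l
  have := congrArg (fun x : Pos d => x l) hij
  simpa [latticePt, hh.ne'] using this

lemma measurable_gridFloor (h : ℝ) : Measurable (gridFloor h : Pos d → Pos d) := by
  unfold gridFloor latticePt cubeIndex
  refine (WithLp.measurable_toLp 2 _).comp (measurable_pi_lambda _ fun l => ?_)
  have h1 : Measurable fun x : Pos d => x l / h := by fun_prop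
  exact measurable_const.mul ((measurable_from_top (f := fun z : ℤ => (z : ℝ))).comp
    (Int.measurable_floor.comp h1))

lemma norm_le_card_mul {x : Pos d} {h : ℝ} (hh : 0 ≤ h) (hx : ∀ l, |x l| ≤ h) : ‖x‖ ≤ d * h := by
  refine abs_le_of_sq_le_sq' ?_ (by positivity) |>.2
  rw [EuclideanSpace.norm_sq_eq]
  calc ∑ l, ‖x l‖ ^ 2 ≤ ∑ _l : Fin d, h ^ 2 := by
        gcongr with l
        exact hx l
    _ = d * h ^ 2 := by simp
    _ ≤ (d * h) ^ 2 := by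
        rw [mul_pow]
        gcongr
        rcases Nat.eq_zero_or_pos d with rfl | hd
        · simp
        · have : (1 : ℝ) ≤ d := by exact_mod_cast hd
          nlinarith

lemma norm_sub_gridFloor_le {h : ℝ} (hh : 0 < h) (x : Pos d) : ‖x - gridFloor h x‖ ≤ d * h := by
  refine norm_le_card_mul hh.le fun l => ?_
  have h1 := Int.floor_le (x l / h)
  have h2 := Int.lt_floor_add_one (x l / h)
  rw [le_div_iff₀ hh] at h1
  rw [div_lt_iff₀ hh] at h2
  simp only [gridFloor, latticePt, cubeIndex, PiLp.sub_apply]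
  rw [abs_le]
  constructor <;> nlinarith

lemma norm_gridFloor_le {h : ℝ} (hh : 0 < h) (x : Pos d) : ‖gridFloor h x‖ ≤ ‖x‖ + d * h := by
  have := norm_sub_norm_le (gridFloor h x) x
  rw [norm_sub_rev] at this
  linarith [norm_sub_gridFloor_le hh x]

lemma cubeIndex_latticePt {h : ℝ} (hh : 0 < h) (i : Fin d → ℤ) :
    cubeIndex h (latticePt h i) = i := by
  funext l
  simp [cubeIndex, latticePt, mul_div_cancel_left₀ _ hh.ne']

lemma cubeIndex_mem_box {h : ℝ} (hh : 0 < h) {m : ℕ} {x : Pos d} (hx : ‖x‖ ≤ m * h) :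
    cubeIndex h x ∈ box d m := by
  rw [box, Fintype.mem_piFinset]
  intro l
  have h1 : |x l| ≤ m * h := (PiLp.norm_apply_le x l).trans hx
  obtain ⟨h2, h3⟩ := abs_le.1 h1
  rw [Finset.mem_Icc]
  constructor
  · rw [cubeIndex, Int.le_floor, le_div_iff₀ hh]
    push_cast
    linarith
  · rw [cubeIndex, ← Int.lt_add_one_iff, Int.floor_lt, div_lt_iff₀ hh]
    push_cast
    nlinarith

lemma measurableSet_cube (h : ℝ) (x : Pos d) : MeasurableSet (cube h x) := by
  unfold cube
  rw [ofPred_forall]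
  refine MeasurableSet.iInter fun l => ?_
  have h1 : Measurable fun y : Pos d => y l := by fun_prop
  exact (measurableSet_le measurable_const h1).inter (measurableSet_lt h1 measurable_const)

/-- The image of a measure under a map that is constant on each piece of a finite partition. -/
lemma map_eq_sum_smul_dirac {Ω X ι : Type*} [MeasurableSpace Ω] [MeasurableSpace X]
    (P : Measure Ω) {F : Finset ι} {A : ι → Set Ω} (hA : ∀ i, MeasurableSet (A i))
    (hdisj : Pairwise (Function.onFun Disjoint A)) (hF : ∀ᵐ z ∂P, ∃ i ∈ F, z ∈ A i)
    {a : Ω → X} (ha : Measurable a) {e : ι → X} (hae : ∀ i, ∀ z ∈ A i, a z = e i) :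
    P.map a = ∑ i ∈ F, P (A i) • Measure.dirac (e i) := by
  ext s hs
  rw [Measure.map_apply ha hs, Measure.coe_finsetSum, Finset.sum_apply]
  have h1 : P (a ⁻¹' s) = P (⋃ i ∈ F, A i ∩ a ⁻¹' s) := by
    refine measure_congr ?_
    filter_upwards [hF] with z ⟨i, hi, hz⟩
    refine propext ⟨fun h => mem_iUnion₂.2 ⟨i, hi, hz, h⟩, fun h => ?_⟩
    obtain ⟨j, -, -, hj⟩ := mem_iUnion₂.1 h
    exact hj
  rw [h1, measure_biUnion_finset]
  · refine Finset.sum_congr rfl fun i _ => ?_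
    rw [Measure.smul_apply, Measure.dirac_apply' _ hs, smul_eq_mul]
    by_cases hi : e i ∈ s
    · have : A i ∩ a ⁻¹' s = A i := inter_eq_left.2 fun z hz => by
        simpa [mem_preimage, hae i z hz] using hi
      rw [this, indicator_of_mem hi, Pi.one_apply, mul_one]
    · have : A i ∩ a ⁻¹' s = ∅ := by
        ext z
        simp only [mem_inter_iff, mem_preimage, mem_empty_iff_false, iff_false, not_and]
        intro hz
        rwa [hae i z hz]
      rw [this, indicator_of_notMem hi, mul_zero, measure_empty]
  · exact fun i _ j _ hij => (hdisj hij).mono inter_subset_left inter_subset_left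
  · exact fun i _ => (hA i).inter (ha hs)

lemma pairwise_disjoint_cube {h : ℝ} (hh : 0 < h) :
    Pairwise (Function.onFun Disjoint fun i : Fin d → ℤ => cube h (latticePt h i)) := by
  intro i j hij
  refine disjoint_left.2 fun x hi hj => hij ?_
  rw [mem_cube_latticePt_iff hh] at hi hj
  exact hi.symm.trans hj

/-- The index box reaches `N³ · T / N² = T N`, so no mass is lost and each cube is sent to its
corner. -/
lemma spaceDisc_eq_map {T : ℝ} (hT : 0 < T) {N : ℕ} (hN : 0 < N) {μ : Measure (Pos d)} {R : ℝ}
    (hμ : ∀ᵐ x ∂μ, ‖x‖ ≤ R) (hR : R ≤ T * N) :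
    spaceDisc T N μ = μ.map (gridFloor (T / N ^ 2)) := by
  have hh : 0 < T / (N : ℝ) ^ 2 := by positivity
  rw [map_eq_sum_smul_dirac μ (F := box d (N ^ 3))
    (fun i => measurableSet_cube (T / N ^ 2) (latticePt (T / N ^ 2) i)) (pairwise_disjoint_cube hh)
    ?_ (measurable_gridFloor _) (e := latticePt (T / N ^ 2)) ?_, spaceDisc]
  · filter_upwards [hμ] with x hx
    refine ⟨_, cubeIndex_mem_box hh ((hx.trans hR).trans_eq ?_), (mem_cube_latticePt_iff hh).2 rfl⟩
    push_cast
    field_simp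
  · intro i x hx
    rw [gridFloor, (mem_cube_latticePt_iff hh).1 hx]

/-- Because `m` lives on the lattice, the sets `{xᵢ} × (vⱼ + [0, 1/N)^d)` exhaust `V m`, and only
velocities are rounded. -/
lemma latStep_eq_map {V : Prob (Pos d) → Prob (TPos d)} (hV : IsPVF V) {T : ℝ} (hT : 0 < T)
    {N : ℕ} (hN : 0 < N) {m : Prob (Pos d)} {R M : ℝ}
    (hm : ∀ᵐ x ∂(m : Measure (Pos d)), ‖x‖ ≤ R) (hR : R ≤ T * N)
    (hgrid : ∀ᵐ x ∂(m : Measure (Pos d)), ∃ i, x = latticePt (T / N ^ 2) i)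
    (hM : ∀ᵐ p ∂(V m : Measure (TPos d)), ‖p.2‖ ≤ M) (hMN : M ≤ N) (s : ℝ) :
    latStep V T N s m =
      (V m : Measure (TPos d)).map fun p => p.1 + s • gridFloor (1 / N) p.2 := by
  have hh : 0 < T / (N : ℝ) ^ 2 := by positivity
  have hk : 0 < 1 / (N : ℝ) := by positivity
  have hmp : IsProbabilityMeasure (m : Measure (Pos d)) := inferInstance
  have hmeas : Measurable fun p : TPos d => p.1 + s • gridFloor (1 / N) p.2 := by
    have := measurable_gridFloor (d := d) (1 / N)
    fun_prop
  rw [latStep, dif_pos hmp, map_eq_sum_smul_dirac (V m : Measure (TPos d))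
    (F := box d (N ^ 3) ×ˢ box d (N ^ 2))
    (A := fun q => {latticePt (T / N ^ 2) q.1} ×ˢ cube (1 / N) (latticePt (1 / N) q.2))
    (e := fun q => latticePt (T / N ^ 2) q.1 + s • latticePt (1 / N) q.2) ?_ ?_ ?_ hmeas ?_,
    Finset.sum_product]
  · rfl
  · exact fun q => (measurableSet_singleton _).prod (measurableSet_cube _ _)
  · rintro ⟨i, j⟩ ⟨i', j'⟩ hne
    refine disjoint_left.2 ?_
    rintro ⟨x, v⟩ ⟨hx, hv⟩ ⟨hx', hv'⟩
    refine hne (Prod.ext (latticePt_injective hh ?_) ?_)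
    · exact (mem_singleton_iff.1 hx).symm.trans (mem_singleton_iff.1 hx')
    · exact ((mem_cube_latticePt_iff hk).1 hv).symm.trans ((mem_cube_latticePt_iff hk).1 hv')
  · filter_upwards [ae_fst_of_ae hV hm, ae_fst_of_ae hV hgrid, hM] with p hp1 ⟨i, hi⟩ hp2
    refine ⟨(i, cubeIndex (1 / N) p.2), Finset.mem_product.2 ⟨?_, ?_⟩, hi,
      (mem_cube_latticePt_iff hk).2 rfl⟩
    · have := cubeIndex_mem_box hh (m := N ^ 3) (x := p.1) ((hp1.trans hR).trans_eq (by
        push_cast; field_simp))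
      rwa [hi, cubeIndex_latticePt hh] at this
    · refine cubeIndex_mem_box hk ((hp2.trans hMN).trans_eq ?_)
      push_cast
      field_simp
  · rintro ⟨i, j⟩ p ⟨hx, hv⟩
    rw [gridFloor, (mem_cube_latticePt_iff hk).1 hv, mem_singleton_iff.1 hx]

end Lattice

/-! ### One step of both schemes compared -/

section LatticeEstimates

variable {d : ℕ} {V : Prob (Pos d) → Prob (TPos d)}

/-- One step of the Lagrangian scheme and one of the lattice scheme, compared by an admissible
plan between the two velocity measures. -/
lemma W1_step_le {R : ℝ} {M L : ℝ≥0} (hVc : ControlledOn V R M L) {μ ν : Prob (Pos d)}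
    (hμ : ∀ᵐ x ∂(μ : Measure (Pos d)), ‖x‖ ≤ R) (hν : ∀ᵐ x ∂(ν : Measure (Pos d)), ‖x‖ ≤ R)
    {g : Pos d → Pos d} (hg : Measurable g) {δ : ℝ≥0} (hgδ : ∀ v, ‖v - g v‖ ≤ L * δ)
    {s : ℝ≥0} (hs : s ≠ 0) :
    W1 (lagStep V s μ : Measure (Pos d))
        ((V ν : Measure (TPos d)).map fun p => p.1 + (s : ℝ) • g p.2) + δ ≤
      (1 + s * L : ℝ≥0) * (W1 (μ : Measure (Pos d)) ν + δ) := by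
  -- Rounding contributes `s L δ`; adding `δ` to both sides then makes the recursion homogeneous
  -- with factor `1 + s L`.
  have key : W1 (lagStep V s μ : Measure (Pos d))
        ((V ν : Measure (TPos d)).map fun p => p.1 + (s : ℝ) • g p.2) ≤
      (W1 (μ : Measure (Pos d)) ν + s * (L * δ)) +
        s * fiberW (V μ : Measure (TPos d)) (V ν : Measure (TPos d)) := by
    refine le_add_mul_fiberW hs fun θ hθ hθW => ?_
    rw [hVc.isPVF, hVc.isPVF] at hθW
    have hma : Measurable fun p : TPos d => p.1 + (s : ℝ) • p.2 := by fun_prop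
    have hmb : Measurable fun p : TPos d => p.1 + (s : ℝ) • g p.2 := by fun_prop
    have huniv : θ univ = 1 := by
      have := congrArg (fun κ : Measure (TPos d) => κ univ) hθ.1
      simpa [Measure.map_apply measurable_fst MeasurableSet.univ] using this
    rw [lagStep_toMeasure, ← hθ.1, ← hθ.2, Measure.map_map hma measurable_fst,
      Measure.map_map hmb measurable_snd, ← hθW]
    refine (W1_map_le θ (hma.comp measurable_fst) (hmb.comp measurable_snd)).trans ?_
    calc _ ≤ ∫⁻ q, (edist q.1.1 q.2.1 + s * (L * δ)) + s * edist q.1.2 q.2.2 ∂θ := by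
          refine lintegral_mono fun q => ?_
          have e : q.1.1 + (s : ℝ) • q.1.2 - (q.2.1 + (s : ℝ) • g q.2.2) =
              (q.1.1 - q.2.1) + (s : ℝ) • (q.2.2 - g q.2.2) + (s : ℝ) • (q.1.2 - q.2.2) := by
            module
          have hb : ‖q.2.2 - g q.2.2‖ₑ ≤ L * δ := by exact_mod_cast hgδ q.2.2
          have hse : ‖(s : ℝ)‖ₑ = s := by simp
          simp only [Function.comp_apply, edist_eq_enorm_sub]
          rw [e]
          refine (enorm_add_le _ _).trans (add_le_add ((enorm_add_le _ _).trans ?_) ?_)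
          · rw [enorm_smul, hse]
            gcongr
          · rw [enorm_smul, hse]
      _ = _ := by
          rw [lintegral_add_left (by fun_prop), lintegral_add_left (by fun_prop),
            lintegral_const, huniv, mul_one, lintegral_const_mul _ (by fun_prop)]
  calc _ ≤ ((W1 (μ : Measure (Pos d)) ν + s * (L * δ)) +
        s * (L * W1 (μ : Measure (Pos d)) ν)) + δ := by
        gcongr
        refine key.trans ?_
        gcongr
        exact hVc.fiberW_le μ ν hμ hν
    _ = _ := by push_cast; ring

end LatticeEstimates

/-! ### The lattice scheme follows the Lagrangian scheme -/

section LatticeScheme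

variable {d : ℕ} {V : Prob (Pos d) → Prob (TPos d)}

lemma VelocityGrowth.mono {C C' : ℝ} (h : VelocityGrowth V C) (hC : C ≤ C') :
    VelocityGrowth V C' := by
  intro μ R hR hμ
  filter_upwards [h μ R hR hμ] with p hp
  exact hp.trans (by gcongr)

lemma latSol_of_mem_Ioc {T : ℝ} {μ₀ : Prob (Pos d)} {N : ℕ} (hτ : 0 < T / N) {k : ℕ} {t : ℝ}
    (h1 : k * (T / N) < t) (h2 : t ≤ (k + 1) * (T / N)) :
    latSol V T μ₀ N t = latStep V T N (t - k * (T / N)) (latNode V T μ₀ N k) := by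
  have ht : ¬ t ≤ 0 := not_le.2 (lt_of_le_of_lt (by positivity) h1)
  rw [latSol, if_neg ht, stepIndex_eq hτ h1 h2]

lemma W1_map_gridFloor_le {h : ℝ} (hh : 0 < h) (μ : Prob (Pos d)) :
    W1 (μ : Measure (Pos d)) ((μ : Measure (Pos d)).map (gridFloor h)) ≤
      ENNReal.ofReal (d * h) := by
  have h1 := W1_map_le (μ : Measure (Pos d)) measurable_id (measurable_gridFloor h)
  rw [Measure.map_id] at h1
  refine h1.trans ?_
  calc _ ≤ ∫⁻ _, ENNReal.ofReal (d * h) ∂(μ : Measure (Pos d)) := by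
        refine lintegral_mono fun x => ?_
        rw [edist_dist, dist_eq_norm]
        exact ENNReal.ofReal_le_ofReal (norm_sub_gridFloor_le hh x)
    _ = _ := by simp

/-- The lattice scheme stays on the lattice and in a ball, and close to the Lagrangian scheme. -/
lemma latNode_spec {C r R : ℝ} {T M L : ℝ≥0} (hC : 0 ≤ C) (hs : VelocityGrowth V C)
    {μ₀ : Prob (Pos d)} (hr : 0 ≤ r) (hT : 0 < T)
    (hμ : ∀ᵐ x ∂(μ₀ : Measure (Pos d)), ‖x‖ ≤ r) {N : ℕ} (hN : 0 < N)
    (hRdef : R = (1 + (r + d * T)) * Real.exp ((C + d) * T))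
    (hVc : ControlledOn V R M L) (hRN : R ≤ T * N) (hMN : (M : ℝ) ≤ N)
    {δ : ℝ≥0} (hδ : L * δ = d / N) {k : ℕ} (hk : k ≤ N) :
    ∃ m : Prob (Pos d), (m : Measure (Pos d)) = latNode V T μ₀ N k ∧
      (∀ᵐ x ∂(m : Measure (Pos d)), ‖x‖ ≤ (1 + (r + d * T)) * (1 + (C + d) * (T / N)) ^ k - 1) ∧
      (∀ᵐ x ∂(m : Measure (Pos d)), ∃ i, x = latticePt (T / N ^ 2) i) ∧
      W1 (lagNode V (T / N) μ₀ k : Measure (Pos d)) m + δ ≤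
        ((d * (T / N ^ 2) + δ) * (1 + T / N * L) ^ k : ℝ≥0) := by
  have hT' : (0 : ℝ) < T := by exact_mod_cast hT
  have hN' : (0 : ℝ) < N := by exact_mod_cast hN
  have hN1 : (1 : ℝ) ≤ N := by exact_mod_cast hN
  have hτ : 0 < (T : ℝ) / N := by positivity
  have hh : 0 < (T : ℝ) / N ^ 2 := by positivity
  have hinv : 0 < 1 / (N : ℝ) := by positivity
  have hCd : 0 ≤ C + d := by positivity
  induction k with
  | zero =>
    have hrR : r ≤ T * N := by
      refine le_trans ?_ hRN
      have : 1 ≤ Real.exp ((C + d) * T) := Real.one_le_exp (by positivity)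
      have : 0 ≤ (d : ℝ) * T := by positivity
      rw [hRdef]
      nlinarith
    have hmap := spaceDisc_eq_map hT' hN hμ hrR
    refine ⟨μ₀.map (f := gridFloor (T / N ^ 2)) (measurable_gridFloor _).aemeasurable, ?_, ?_, ?_,
      ?_⟩
    · rw [latNode, hmap]; rfl
    · change ∀ᵐ x ∂((μ₀ : Measure (Pos d)).map (gridFloor (T / N ^ 2))), _
      rw [ae_map_iff (measurable_gridFloor _).aemeasurable
        (measurableSet_le (by fun_prop) (by fun_prop))]
      filter_upwards [hμ] with x hx
      have h1 := norm_gridFloor_le hh x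
      have h2 : (T : ℝ) / N ^ 2 ≤ T := div_le_self hT'.le (one_le_pow₀ hN1)
      have h3 : (d : ℝ) * (T / N ^ 2) ≤ d * T := by gcongr
      simp only [pow_zero]
      linarith
    · change ∀ᵐ x ∂((μ₀ : Measure (Pos d)).map (gridFloor (T / N ^ 2))), _
      refine (ae_map_iff (measurable_gridFloor _).aemeasurable ?_).2
        (Eventually.of_forall fun x => ⟨_, rfl⟩)
      exact (countable_range (latticePt ((T : ℝ) / N ^ 2) : (Fin d → ℤ) → Pos d)).measurableSet.congr
        (by ext; simp [eq_comm])
    · rw [pow_zero, mul_one]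
      push_cast
      gcongr
      refine (W1_map_gridFloor_le hh μ₀).trans (le_of_eq ?_)
      have : (d : ℝ) * (T / N ^ 2) = ((d * (T / N ^ 2) : ℝ≥0) : ℝ) := by push_cast; rfl
      rw [this, ENNReal.ofReal_coe_nnreal]
      push_cast
      rfl
  | succ k ih =>
    obtain ⟨m, hm, hmr, hmg, hmW⟩ := ih (Nat.le_of_succ_le hk)
    set ρ : ℝ := (1 + (r + d * T)) * (1 + (C + d) * (T / N)) ^ k - 1 with hρ
    have hpow : 1 ≤ (1 + (C + d) * (T / N : ℝ)) ^ k :=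
      one_le_pow₀ (by nlinarith [mul_nonneg hCd hτ.le])
    have hdT : 0 ≤ (d : ℝ) * T := by positivity
    have hρ0 : 0 ≤ ρ := by rw [hρ]; nlinarith
    have hρR : ρ ≤ R := by
      have := growth_le_exp (r := r + d * T) (by positivity) hCd hτ.le
        (by field_simp : (N : ℝ) * (T / N) = T) hk (s := 0) hτ.le
      rw [hρ, hRdef]
      linarith
    have hmR : ∀ᵐ x ∂(m : Measure (Pos d)), ‖x‖ ≤ R := hmr.mono fun x hx => hx.trans hρR
    -- Relaxing `C` to `C + d` and `r` to `r + d T` puts the Lagrangian scheme in the same ball.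
    have hlag : ∀ᵐ x ∂(lagNode V (T / N) μ₀ k : Measure (Pos d)), ‖x‖ ≤ R :=
      (ae_norm_le_lagNode hVc.isPVF hCd (hs.mono (by simp)) (r := r + d * T) (by positivity) hτ.le
        (hμ.mono fun x hx => hx.trans (by linarith)) k).mono fun x hx => hx.trans hρR
    have hstep := latStep_eq_map hVc.isPVF hT' hN hmR hRN hmg (hVc.velocity_le m hmR) hMN (T / N)
    have hmeas : Measurable fun p : TPos d => p.1 + ((T : ℝ) / N) • gridFloor (1 / N) p.2 := by
      have := measurable_gridFloor (d := d) (1 / N)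
      fun_prop
    refine ⟨(V m).map hmeas.aemeasurable, ?_, ?_, ?_, ?_⟩
    · rw [latNode, ← hm, hstep]; rfl
    -- Rounding adds at most `d / N ≤ d (1 + ρ)` to a velocity, whence `C + d`.
    · have := ae_norm_le_map_step hVc.isPVF hs hρ0 hτ.le hmr (measurable_gridFloor (1 / N))
        (C' := C + d) fun v hv => by
          have h1 := norm_gridFloor_le hinv v
          have h2 : (d : ℝ) * (1 / N) ≤ d * 1 := by
            gcongr
            exact (div_le_one hN').2 hN1
          have : 0 ≤ (d : ℝ) * ρ := by positivity
          nlinarith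
      rw [hρ, add_sub_cancel, mul_assoc, ← pow_succ] at this
      exact this
    · change ∀ᵐ x ∂((V m : Measure (TPos d)).map _), _
      refine (ae_map_iff hmeas.aemeasurable ?_).2 ?_
      · exact (countable_range
          (latticePt ((T : ℝ) / N ^ 2) : (Fin d → ℤ) → Pos d)).measurableSet.congr
          (by ext; simp [eq_comm])
      · filter_upwards [ae_fst_of_ae hVc.isPVF hmg] with p ⟨i, hi⟩
        -- The mesh sizes fit: `(T / N) · (1 / N) = T / N²`, so a full step stays on the lattice.
        refine ⟨i + cubeIndex (1 / N) p.2, ?_⟩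
        rw [hi]
        ext l
        simp only [gridFloor, latticePt, PiLp.add_apply, PiLp.smul_apply, smul_eq_mul,
          Pi.add_apply, Int.cast_add]
        field_simp
    · have := W1_step_le hVc hlag hmR (measurable_gridFloor (1 / N)) (δ := δ)
        (fun v => (norm_sub_gridFloor_le hinv v).trans_eq (by
          have := congrArg (fun z : ℝ≥0 => (z : ℝ)) hδ
          push_cast at this
          rw [this, mul_one_div])) (s := T / N) (by positivity)
      refine (le_of_eq ?_).trans (this.trans ((mul_le_mul_right hmW _).trans (le_of_eq ?_)))
      · rw [lagNode]
        push_cast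
        rfl
      · push_cast
        ring

/-- A partial step from the preceding node extends the nodal comparison to all times: initial
rounding plus the constant `δ`, times a Gronwall factor. -/
lemma exists_latSol_eq {C r R : ℝ} {T M L : ℝ≥0} (hC : 0 ≤ C) (hs : VelocityGrowth V C)
    {μ₀ : Prob (Pos d)} (hr : 0 ≤ r) (hT : 0 < T)
    (hμ : ∀ᵐ x ∂(μ₀ : Measure (Pos d)), ‖x‖ ≤ r) {N : ℕ} (hN : 0 < N)
    (hRdef : R = (1 + (r + d * T)) * Real.exp ((C + d) * T))
    (hVc : ControlledOn V R M L) (hRN : R ≤ T * N) (hMN : (M : ℝ) ≤ N) {t : ℝ}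
    (ht : t ∈ Icc (0 : ℝ) T) :
    ∃ m : Prob (Pos d), (m : Measure (Pos d)) = latSol V T μ₀ N t ∧
      W1 (lagScheme V T μ₀ N t : Measure (Pos d)) m ≤
        ENNReal.ofReal ((d * (T / N ^ 2) + d / N / L) * Real.exp (L * T)) := by
  have hT' : (0 : ℝ) < T := by exact_mod_cast hT
  have hN' : (0 : ℝ) < N := by exact_mod_cast hN
  have hτ : 0 < (T : ℝ) / N := by positivity
  have hNτ : (N : ℝ) * (T / N) = T := by field_simp
  have hinv : 0 < 1 / (N : ℝ) := by positivity
  have hCd : 0 ≤ C + d := by positivity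
  -- Chosen so that `L δ = d / N`, the rounding error of the velocities.
  set δ : ℝ≥0 := d / N / L with hδdef
  have hδ : L * δ = d / N := mul_div_cancel₀ _ hVc.lip_pos
  have hLpos : (0 : ℝ) ≤ L := L.2
  rcases ht.1.eq_or_lt with h0 | h0
  · obtain ⟨m, hm, -, -, hW⟩ := latNode_spec hC hs hr hT hμ hN hRdef hVc hRN hMN hδ (Nat.zero_le N)
    refine ⟨m, ?_, ?_⟩
    · rw [hm, ← h0, latSol, if_pos le_rfl, latNode]
    · have hl : lagScheme V T μ₀ N t = lagNode V (T / N) μ₀ 0 := by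
        rw [← h0, lagScheme, if_pos le_rfl, lagNode]
      rw [hl]
      refine (le_self_add.trans hW).trans ?_
      rw [pow_zero, mul_one, ← ENNReal.ofReal_coe_nnreal]
      refine ENNReal.ofReal_le_ofReal ?_
      push_cast
      exact le_mul_of_one_le_right (by positivity) (Real.one_le_exp (by positivity))
  · obtain ⟨k, hk, h1, h2⟩ := exists_cell hτ h0 (hNτ.symm ▸ ht.2)
    obtain ⟨m, hm, hmr, hmg, hmW⟩ := latNode_spec hC hs hr hT hμ hN hRdef hVc hRN hMN hδ hk.le
    have hρR : (1 + (r + d * T)) * (1 + (C + d) * (T / N)) ^ k - 1 ≤ R := by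
      have := growth_le_exp (r := r + d * T) (by positivity) hCd hτ.le hNτ hk (s := 0) hτ.le
      rw [hRdef]
      linarith
    have hmR : ∀ᵐ x ∂(m : Measure (Pos d)), ‖x‖ ≤ R := hmr.mono fun x hx => hx.trans hρR
    have hdT : 0 ≤ (d : ℝ) * T := by positivity
    have hlag : ∀ᵐ x ∂(lagNode V (T / N) μ₀ k : Measure (Pos d)), ‖x‖ ≤ R :=
      (ae_norm_le_lagNode hVc.isPVF hCd (hs.mono (by simp)) (r := r + d * T) (by positivity) hτ.le
        (hμ.mono fun x hx => hx.trans (by linarith)) k).mono fun x hx => hx.trans hρR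
    obtain ⟨s, hst⟩ : ∃ s : ℝ≥0, (s : ℝ) = t - k * (T / N) := ⟨⟨_, by linarith⟩, rfl⟩
    have hs0 : s ≠ 0 := by
      rintro rfl
      simp only [NNReal.coe_zero] at hst
      linarith
    have hmeas : Measurable fun p : TPos d => p.1 + (s : ℝ) • gridFloor (1 / N) p.2 := by
      have := measurable_gridFloor (d := d) (1 / N)
      fun_prop
    refine ⟨(V m).map hmeas.aemeasurable, ?_, ?_⟩
    · rw [latSol_of_mem_Ioc hτ h1 h2, ← hm, latStep_eq_map hVc.isPVF hT' hN hmR hRN hmg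
        (hVc.velocity_le m hmR) hMN, ← hst]
      rfl
    · rw [lagScheme_of_mem_Ioc hτ h1 h2, ← hst]
      have := W1_step_le hVc hlag hmR (measurable_gridFloor (1 / N)) (δ := δ)
        (fun v => (norm_sub_gridFloor_le hinv v).trans_eq (by
          have := congrArg (fun z : ℝ≥0 => (z : ℝ)) hδ
          push_cast at this
          rw [this, mul_one_div])) hs0
      refine (le_self_add.trans this).trans ((mul_le_mul_right hmW _).trans ?_)
      rw [← ENNReal.coe_mul, ← ENNReal.ofReal_coe_nnreal]
      refine ENNReal.ofReal_le_ofReal ?_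
      have hg := growth_le_exp (r := 0) le_rfl hLpos hτ.le hNτ hk (s := s)
        (by rw [hst]; linarith)
      push_cast
      calc (1 + (s : ℝ) * L) * ((d * (T / N ^ 2) + d / N / L) * (1 + T / N * L) ^ k)
          = (d * (T / N ^ 2) + d / N / L) * ((1 + 0) * (1 + L * (T / N)) ^ k * (1 + L * s)) := by
            ring
        _ ≤ (d * (T / N ^ 2) + d / N / L) * ((1 + 0) * Real.exp (L * T)) := by gcongr
        _ = _ := by ring

end LatticeScheme

/-! ### Asymptotically equal sequences have equal limits -/

section Comparison

variable {d : ℕ}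

lemma eq_of_tendsto_W1_of_tendsto_W1 {a b : ℕ → Prob (Pos d)} {μ ν : Prob (Pos d)}
    (hab : Tendsto (fun n => W1 (a n : Measure (Pos d)) (b n)) atTop (𝓝 0))
    (ha : Tendsto (fun n => W1 (a n : Measure (Pos d)) μ) atTop (𝓝 0))
    (hb : Tendsto (fun n => W1 (b n : Measure (Pos d)) ν) atTop (𝓝 0)) : μ = ν := by
  have ha' := tendsto_of_tendsto_W1 ha
  have hb' := tendsto_of_tendsto_W1 hb
  refine tendsto_nhds_unique ha' ?_
  rw [tendsto_iff_forall_lipschitz_integral_tendsto] at hb' ⊢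
  rintro f hbd ⟨K, hf⟩
  have h0 : Tendsto (fun n => ∫ x, f x ∂(a n : Measure (Pos d)) -
      ∫ x, f x ∂(b n : Measure (Pos d))) atTop (𝓝 0) := by
    refine tendsto_of_enorm_sub_le (K := K + 1) hab (Eventually.of_forall fun n => ?_)
    rw [sub_zero]
    exact enorm_integral_sub_le_W1 (by positivity) (hf.weaken (by simp))
      (integrable_of_lipschitz_of_bounded hf hbd _) (integrable_of_lipschitz_of_bounded hf hbd _)
  simpa using h0.add (hb' f hbd ⟨K, hf⟩)

end Comparison

end MDE

theorem theorem4p1 (d : ℕ) (T : ℝ) (hT : 0 < T)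
    (V : MDE.Prob (MDE.Pos d) → MDE.Prob (MDE.TPos d)) (hV : MDE.IsPVF V)
    (hsub : MDE.Sublinear V) (hlip : MDE.LocLip V)
    (μ₀ : MDE.Prob (MDE.Pos d)) (hμ₀ : MDE.CompSupp μ₀) :
    (∃ φ : ℕ → ℕ, StrictMono φ ∧ ∃ μ : ℝ → MDE.Prob (MDE.Pos d),
      MDE.IsSolution V T μ₀ μ ∧ (∀ t ∈ Icc 0 T, MDE.CompSupp (μ t)) ∧
      Tendsto (fun n => ⨆ t ∈ Icc 0 T,
          MDE.W1 (MDE.lagScheme V T μ₀ (φ n) t : Measure (MDE.Pos d)) (μ t : Measure (MDE.Pos d)))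
        atTop (𝓝 0)) ∧
    (∀ φ : ℕ → ℕ, StrictMono φ → ∀ μ ν : ℝ → MDE.Prob (MDE.Pos d),
      (∀ t ∈ Icc 0 T, Tendsto (fun n =>
          MDE.W1 (MDE.lagScheme V T μ₀ (φ n) t : Measure (MDE.Pos d)) (μ t : Measure (MDE.Pos d)))
        atTop (𝓝 0)) →
      (∀ t ∈ Icc 0 T, Tendsto (fun n =>
          MDE.W1 (MDE.latSol V T μ₀ (φ n) t) (ν t : Measure (MDE.Pos d)))
        atTop (𝓝 0)) →
      (∀ t ∈ Icc 0 T, μ t = ν t ∧ MDE.CompSupp (μ t)) ∧ MDE.IsSolution V T μ₀ μ) := by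
  open MDE in
  obtain ⟨r, hr, hμr⟩ := hμ₀.exists_ae_norm_le
  obtain ⟨C, hC, hgrowth⟩ := hsub.exists_velocityGrowth
  lift T to ℝ≥0 using hT.le
  have hT0 : 0 < T := by exact_mod_cast hT
  -- Rounding enlarges the initial radius by at most `d T` and the growth constant by `d`; this ball
  -- serves both schemes.
  obtain ⟨R, hRdef⟩ : ∃ R : ℝ, R = (1 + (r + d * T)) * Real.exp ((C + d) * T) := ⟨_, rfl⟩
  have hR : 0 ≤ R := by rw [hRdef]; positivity
  obtain ⟨M, L, hVc⟩ := exists_controlledOn hV hC.le hgrowth hlip hR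
  have hdT : 0 ≤ (d : ℝ) * T := by positivity
  have hEuler : ∀ N : ℕ, 0 < N → IsEulerCurve V (T / N) N R (lagScheme V T μ₀ N) := fun N hN => by
    rw [hRdef]
    exact isEulerCurve_lagScheme hV (by positivity) (hgrowth.mono (by simp)) (by positivity) hT
      (hμr.mono fun x hx => hx.trans (by linarith)) hN
  have hNT : ∀ N : ℕ, 0 < N → N * ((T : ℝ) / N) = T := fun N hN => by
    have : (N : ℝ) ≠ 0 := by positivity
    field_simp
  have hlimit : ∀ φ : ℕ → ℕ, StrictMono φ → ∀ μ : ℝ → Prob (Pos d),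
      (∀ t ∈ Icc (0 : ℝ) T, Tendsto (fun n =>
        W1 (lagScheme V T μ₀ (φ n) t : Measure (Pos d)) (μ t : Measure (Pos d))) atTop (𝓝 0)) →
      (∀ t ∈ Icc (0 : ℝ) T, ∀ᵐ x ∂(μ t : Measure (Pos d)), ‖x‖ ≤ R) ∧ IsSolution V T μ₀ μ := by
    intro φ hφ μ h
    have hpos : ∀ᶠ n in atTop, 0 < φ n := hφ.tendsto_atTop.eventually_gt_atTop 0
    refine isSolution_of_tendsto_W1 hT hVc (fun n => by simp [lagScheme]) (N := φ)
      (τ := fun n => T / φ n) ?_ (hpos.mono fun n hn => hNT _ hn)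
      (hpos.mono fun n hn => hEuler _ hn) h
    exact tendsto_const_nhds.div_atTop (tendsto_natCast_atTop_atTop.comp hφ.tendsto_atTop)
  refine ⟨?_, fun φ hφ μ ν hμ hν => ?_⟩
  · obtain ⟨φ, hφ, μ, hlim⟩ := exists_subseq_tendsto_iSup_W1 (T := T) hR (M := M)
      (c := lagScheme V T μ₀)
      ((eventually_gt_atTop 0).mono fun N hN t ht =>
        (hEuler N hN).norm_le t ((hNT N hN).symm ▸ ht))
      ((eventually_gt_atTop 0).mono fun N hN f K hK hf s t h0 hst ht =>
        (hEuler N hN).abs_integral_sub_le hVc hK hf h0 hst ((hNT N hN).symm ▸ ht))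
    obtain ⟨h1, h2⟩ := hlimit φ hφ μ fun t ht =>
      tendsto_of_tendsto_of_tendsto_of_le_of_le tendsto_const_nhds hlim (fun _ => zero_le)
        fun n => le_iSup₂ (f := fun t (_ : t ∈ Icc (0 : ℝ) T) =>
          W1 (lagScheme V T μ₀ (φ n) t : Measure (Pos d)) (μ t : Measure (Pos d))) t ht
    exact ⟨φ, hφ, μ, h2, fun t ht => compSupp_of_ae_norm_le (h1 t ht), hlim⟩
  · obtain ⟨h1, h2⟩ := hlimit φ hφ μ hμ
    refine ⟨fun t ht => ⟨?_, compSupp_of_ae_norm_le (h1 t ht)⟩, h2⟩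
    have hcast : Tendsto (fun n => (φ n : ℝ)) atTop atTop :=
      tendsto_natCast_atTop_atTop.comp hφ.tendsto_atTop
    have hlarge : ∀ᶠ n in atTop, 0 < φ n ∧ R ≤ T * φ n ∧ (M : ℝ) ≤ φ n :=
      (hφ.tendsto_atTop.eventually_gt_atTop 0).and
        (((hcast.const_mul_atTop hT).eventually_ge_atTop R).and (hcast.eventually_ge_atTop _))
    have hex : ∀ n, ∃ m : Prob (Pos d), (0 < φ n ∧ R ≤ T * φ n ∧ (M : ℝ) ≤ φ n) →
        (m : Measure (Pos d)) = latSol V T μ₀ (φ n) t ∧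
        W1 (lagScheme V T μ₀ (φ n) t : Measure (Pos d)) m ≤ ENNReal.ofReal
          ((d * (T / φ n ^ 2) + d / φ n / L) * Real.exp (L * T)) := by
      intro n
      by_cases h : 0 < φ n ∧ R ≤ T * φ n ∧ (M : ℝ) ≤ φ n
      · obtain ⟨m, hm⟩ := exists_latSol_eq hC.le hgrowth hr hT0 hμr h.1 hRdef hVc h.2.1 h.2.2 ht
        exact ⟨m, fun _ => hm⟩
      · exact ⟨μ₀, fun h' => absurd h' h⟩
    choose m hm using hex
    refine eq_of_tendsto_W1_of_tendsto_W1 (b := m) ?_ (hμ t ht) ((hν t ht).congr' ?_)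
    · refine tendsto_of_tendsto_of_tendsto_of_le_of_le' tendsto_const_nhds ?_
        (Eventually.of_forall fun _ => zero_le) (hlarge.mono fun n hn => (hm n hn).2)
      rw [← ENNReal.ofReal_zero]
      refine ENNReal.tendsto_ofReal ?_
      have e1 : Tendsto (fun n => (T : ℝ) / (φ n : ℝ) ^ 2) atTop (𝓝 0) :=
        tendsto_const_nhds.div_atTop ((tendsto_pow_atTop two_ne_zero).comp hcast)
      have e2 : Tendsto (fun n => (d : ℝ) / φ n) atTop (𝓝 0) := tendsto_const_nhds.div_atTop hcast
      simpa using ((e1.const_mul (d : ℝ)).add (e2.div_const (L : ℝ))).mul_const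
        (Real.exp (L * T))
    · filter_upwards [hlarge] with n hn
      rw [(hm n hn).1]
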